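/- Let $X$ be a compact Hausdorff space and $\sigma_1,\dots,\sigma_n:X\to X$ continuous maps ($n\ge 0$). The semicrossed product $A=C(X)\rtimes_\sigma\mathbb F_n^+$ is the universal operator algebra generated by $C(X)$ and contractions $S_1,\dots,S_n$ with $fS_i=S_i(f\circ\sigma_i)$ for all $f\in C(X)$. The tensor algebra $\mathcal A(Y,\tau)$ of a system $(Y,\tau_1,\dots,\tau_m)$ of the same kind is the universal operator algebra generated by $C(Y)$ and $T_1,\dots,T_m$ with $fT_j=T_j(f\circ\tau_j)$ and $\|[T_1\ \cdots\ T_m]\|\le 1$. *The graph of $A$.* Let $\Delta(A)=A\cap A^*$, let $V(A)$ be the space of characters of $\Delta(A)$ (each $v\in V(A)$ restricts on $C(X)$ to evaluation at a point, also written $v$), and let $\varphi:A\to\Delta(A)$ be the completely contractive homomorphism that is the identity on $\Delta(A)$ and has $\varphi(S_i)=0$ for all $i$. For $v,w\in V(A)$ let $E_{w,v}$ be the quotient of $\ker\varphi$ by its intersection with the kernels of all completely contractive representations $$a\mapsto\begin{bmatrix} w(\varphi(a)) & t(a)\\ 0& v(\varphi(a))\end{bmatrix},\qquad t\neq 0 ,$$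 of $A$. Take as basis of $E_{w,v}$ the classes of those $S_i$ with $\sigma_i(v)=w$. Each basis element is an edge $e$ with source $s(e)=v$ and range $r(e)=w$; its functional $t_e:A\to\mathbb C$ vanishes on $\Delta(A)$ and on $\ker\varphi$ is the corresponding coordinate functional. The edges are partitioned into the classes $E_1,\dots,E_n$, where $E_i$ consists of the edges given by $S_i$. An edge coloring is a function $c:\{1,\dots,n\}\to\mathbb N$ such that $c(i)\ne c(j)$ whenever there are edges $e_1\in E_i$, $e_2\in E_j$ with $r(e_1)=r(e_2)$ for which $$a\mapsto\begin{bmatrix} r(e_1)(\varphi(a)) & t_{e_1}(a) & t_{e_2}(a)\\ 0& s(e_1)(\varphi(a))&0\\0&0&s(e_2)(\varphi(a))\end{bmatrix}$$ is a completely contractive representation of $A$. The graph is $1$-colorable if there is an edge coloring that uses at most one color. **Proposition.** This graph exists: $\varphi$ exists; the classes of the $S_i$ with $\sigma_i(v)=w$ do form a basis of $E_{w,v}$; for each basis element $e$ the map $a\mapsto\begin{bmatrix} w(\varphi(a)) & t_e(a)\\ 0& v(\varphi(a))\end{bmatrix}$ is a completely contractive representation; and the partition $E_1,\dots,E_n$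 is topological, that is, distinct edges of one class have distinct sources and, on the subspace $\{(i,s(e)) : e\in E_i\}$ of $\{1,\dots,n\}\times V(A)$, the source map $(i,s(e))\mapsto s(e)$ is a local homeomorphism and the range map $(i,s(e))\mapsto r(e)$ is continuous and proper. Moreover, $C(X)\rtimes_\sigma\mathbb F_n^+$ is completely isometrically isomorphic to a tensor algebra $\mathcal A(Y,\tau)$ of some system $(Y,\tau_1,\dots,\tau_m)$, with $Y$ compact Hausdorff, $m\ge0$ and the $\tau_j$ continuous, if and only if its graph is $1$-colorable. -/

import Mathlib

open scoped ENNReal Topology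

universe u v w

noncomputable section

namespace OpAlg

/-! ## Operator algebras on Hilbert space and their matrix norms

An operator algebra is a unital subalgebra `A` of the bounded operators on a Hilbert space `H`
(the two families of operator algebras constructed below are norm closed).
Its matrix norms are those of operators on the Hilbert space `H ⊕ ⋯ ⊕ H`. -/

section Matrices

variable {H : Type u} [NormedAddCommGroup H] [InnerProductSpace ℂ H]

/-- A `k × k` matrix of operators on `H`, as an operator on the Hilbert sum of `k` copies of
`H`. -/
def matOp {k : ℕ} (M : Matrix (Fin k) (Fin k) (H →L[ℂ] H)) :
    PiLp 2 (fun _ : Fin k => H) →L[ℂ] PiLp 2 (fun _ : Fin k => H) :=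
  ((PiLp.continuousLinearEquiv 2 ℂ (fun _ : Fin k => H)).symm :
      (Fin k → H) →L[ℂ] PiLp 2 (fun _ : Fin k => H)) ∘L
    ContinuousLinearMap.pi (fun i => ∑ j, M i j ∘L PiLp.proj 2 (fun _ : Fin k => H) j)

variable {K : Type v} [NormedAddCommGroup K] [InnerProductSpace ℂ K]

/-- A linear map from an operator algebra to the operators on `K` is completely contractive if
all its matrix amplifications are contractive. -/
def IsCompletelyContractive (A : Subalgebra ℂ (H →L[ℂ] H)) (f : A →ₗ[ℂ] (K →L[ℂ] K)) : Prop :=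
  ∀ (k : ℕ) (M : Matrix (Fin k) (Fin k) A),
    ‖matOp (M.map fun a => f a)‖ ≤ ‖matOp (M.map fun a => (a : H →L[ℂ] H))‖

/-- Two operator algebras are completely isometrically isomorphic if there is an algebra
isomorphism between them all of whose matrix amplifications are isometric. -/
def CompletelyIsometricallyIsomorphic (A : Subalgebra ℂ (H →L[ℂ] H))
    (B : Subalgebra ℂ (K →L[ℂ] K)) : Prop :=
  ∃ e : A ≃ₐ[ℂ] B, ∀ (k : ℕ) (M : Matrix (Fin k) (Fin k) A),
    ‖matOp (M.map fun a => (e a : K →L[ℂ] K))‖ = ‖matOp (M.map fun a => (a : H →L[ℂ] H))‖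

/-- A representation by `p × p` matrices is completely contractive; the matrices act on the
Hilbert space `ℂ^p`. -/
def IsCCRep (A : Subalgebra ℂ (H →L[ℂ] H)) {p : ℕ}
    (T : A →ₐ[ℂ] Matrix (Fin p) (Fin p) ℂ) : Prop :=
  IsCompletelyContractive A
    ((Matrix.toEuclideanCLM (n := Fin p) (𝕜 := ℂ)).toAlgEquiv.toLinearMap ∘ₗ T.toLinearMap)

end Matrices

/-! ## The edge-coloured graph of an operator algebra -/

section Graph

variable {H : Type u} [NormedAddCommGroup H] [InnerProductSpace ℂ H] [CompleteSpace H]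

/-- The diagonal `Δ(A) = A ∩ A*`. -/
def diagonal (A : Subalgebra ℂ (H →L[ℂ] H)) : StarSubalgebra ℂ (H →L[ℂ] H) where
  carrier := {a | a ∈ A ∧ star a ∈ A}
  mul_mem' := fun ha hb => ⟨A.mul_mem ha.1 hb.1, by rw [star_mul]; exact A.mul_mem hb.2 ha.2⟩
  one_mem' := ⟨A.one_mem, by rw [star_one]; exact A.one_mem⟩
  add_mem' := fun ha hb => ⟨A.add_mem ha.1 hb.1, by rw [star_add]; exact A.add_mem ha.2 hb.2⟩
  zero_mem' := ⟨A.zero_mem, by rw [star_zero]; exact A.zero_mem⟩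
  algebraMap_mem' := fun c =>
    ⟨A.algebraMap_mem c, by rw [← algebraMap_star_comm]; exact A.algebraMap_mem _⟩
  star_mem' := fun ha => ⟨ha.2, by rw [star_star]; exact ha.1⟩

/-- The vertex set `V(A)`: the multiplicative linear functionals on `Δ(A)`, with the weak-*
topology. -/
abbrev Vertex (A : Subalgebra ℂ (H →L[ℂ] H)) : Type u :=
  WeakDual.characterSpace ℂ (diagonal A)

/-- A completely contractive map `φ : A → Δ(A)` that is the identity on `Δ(A)`. -/
structure DiagonalExpectation (A : Subalgebra ℂ (H →L[ℂ] H)) where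
  toLin : A →ₗ[ℂ] diagonal A
  completelyContractive :
    IsCompletelyContractive A ((diagonal A).toSubalgebra.val.toLinearMap ∘ₗ toLin)
  map_diagonal : ∀ (a : A) (ha : (a : H →L[ℂ] H) ∈ diagonal A), toLin a = ⟨a, ha⟩

variable {A : Subalgebra ℂ (H →L[ℂ] H)}

namespace DiagonalExpectation

/-- The kernel of `φ`. -/
abbrev kernel (φ : DiagonalExpectation A) : Submodule ℂ A := LinearMap.ker φ.toLin

instance instAddCommGroupKernel (φ : DiagonalExpectation A) : AddCommGroup φ.kernel :=
  Submodule.addCommGroup (M := A) φ.kernel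

/-- The projection `a ↦ a - φ(a)` of `A` onto `ker φ`; it vanishes on `Δ(A)` and is the identity
on `ker φ`. -/
def offDiagonal (φ : DiagonalExpectation A) : A →ₗ[ℂ] φ.kernel where
  toFun a := ⟨a - ⟨φ.toLin a, (φ.toLin a).2.1⟩, by
    rw [LinearMap.mem_ker, map_sub, φ.map_diagonal ⟨φ.toLin a, (φ.toLin a).2.1⟩ (φ.toLin a).2]
    exact sub_self _⟩
  map_add' a b := by
    ext1; ext1
    simp only [map_add, Submodule.coe_add, AddSubgroupClass.coe_sub, Subalgebra.coe_add]
    exact add_sub_add_comm _ _ _ _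
  map_smul' c a := by
    ext1; ext1
    simp only [map_smul, RingHom.id_apply, Submodule.coe_smul, AddSubgroupClass.coe_sub,
      Subalgebra.coe_smul]
    exact (smul_sub _ _ _).symm

/-- The completely contractive representations
`a ↦ [[w(φ(a)), t(a)], [0, v(φ(a))]]` of `A` with `t ≠ 0`. -/
def nestReps (φ : DiagonalExpectation A) (w v : Vertex A) :
    Set (A →ₐ[ℂ] Matrix (Fin 2) (Fin 2) ℂ) :=
  {T | IsCCRep A T ∧ ∃ t : A →ₗ[ℂ] ℂ, t ≠ 0 ∧
    ∀ a, T a = !![w (φ.toLin a), t a; 0, v (φ.toLin a)]}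

/-- `K_{w,v}`, the intersection of the kernels of the representations in `nestReps φ w v`. -/
def nestKernel (φ : DiagonalExpectation A) (w v : Vertex A) : Submodule ℂ A :=
  ⨅ T ∈ φ.nestReps w v, LinearMap.ker (AlgHom.toLinearMap T)

/-- `E_{w,v} = ker φ / K_{w,v}`, that is, `ker φ` modulo `ker φ ∩ K_{w,v}`. Its elements are
connections from the source `v` to the range `w`. -/
abbrev EdgeSpace (φ : DiagonalExpectation A) (w v : Vertex A) : Type u :=
  φ.kernel ⧸ (φ.nestKernel w v).comap φ.kernel.subtype

/-- The map `q : A → E_{w,v}` that is zero on `Δ(A)` and the quotient map on `ker φ`. -/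
def quot (φ : DiagonalExpectation A) (w v : Vertex A) : A →ₗ[ℂ] φ.EdgeSpace w v :=
  Submodule.mkQ _ ∘ₗ φ.offDiagonal

end DiagonalExpectation

/-- A choice of bases of all the spaces `E_{w,v}`, the basis of `E_{w,v}` being indexed by
`I w v`, which witnesses that `A` is edge free: for each basis element, with coordinate functional
`t`, the map `a ↦ [[w(φ(a)), t(q(a))], [0, v(φ(a))]]` is a completely contractive homomorphism. -/
structure EdgeFamily (φ : DiagonalExpectation A) (I : Vertex A → Vertex A → Type v) where
  basis : ∀ w v, Module.Basis (I w v) ℂ (φ.EdgeSpace w v)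
  edgeFree : ∀ w v (i : I w v), ∃ T : A →ₐ[ℂ] Matrix (Fin 2) (Fin 2) ℂ, IsCCRep A T ∧
    ∀ a, T a = !![w (φ.toLin a), (basis w v).coord i (φ.quot w v a); 0, v (φ.toLin a)]

/-- The edge set `E(A)`: one edge from `v` to `w` for each element of the basis of `E_{w,v}`. -/
structure Edge (I : Vertex A → Vertex A → Type v) where
  range : Vertex A
  source : Vertex A
  idx : I range source

variable {I : Vertex A → Vertex A → Type v} {Λ : Type w}

/-- The linear functional `t_e : A → ℂ` of an edge `e`. -/
def EdgeFamily.functional {φ : DiagonalExpectation A} (𝓔 : EdgeFamily φ I) (e : Edge I) :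
    A →ₗ[ℂ] ℂ :=
  (𝓔.basis e.range e.source).coord e.idx ∘ₗ φ.quot e.range e.source

/-- The space `E_Λ ⊆ Λ × V(A)` of a partition of the edges into the classes
`E_l = {e | part e = l}`. -/
def partitionSpace (part : Edge I → Λ) : Set (Λ × Vertex A) :=
  {p | ∃ e, part e = p.1 ∧ e.source = p.2}

/-- The range map on `E_Λ`; it does not depend on the choice if distinct edges of one class have
distinct sources. -/
def partitionRange (part : Edge I → Λ) (p : partitionSpace part) : Vertex A :=
  p.2.choose.range

/-- The partition of the edges into the classes `E_l = {e | part e = l}` is a topological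
partition: distinct edges of one class have distinct sources and, with the discrete topology on
`Λ`, the source map of `E_Λ` is a local homeomorphism and the range map is continuous and
proper. -/
structure IsTopologicalPartition [TopologicalSpace Λ] [DiscreteTopology Λ]
    (part : Edge I → Λ) : Prop where
  source_ne : ∀ e f, part e = part f → e ≠ f → e.source ≠ f.source
  source_localHomeo : IsLocalHomeomorph fun p : partitionSpace part => p.1.2
  range_continuous : Continuous (partitionRange part)
  range_proper : IsProperMap (partitionRange part)

/-- Edge colourings `c : Λ → ℕ`: `c l₁ ≠ c l₂` whenever there are edges `e₁ ∈ E_{l₁}` and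
`e₂ ∈ E_{l₂}` with the same range such that
`a ↦ [[r(e₁)(a), t₁(a), t₂(a)], [0, s(e₁)(a), 0], [0, 0, s(e₂)(a)]]`
is a completely contractive representation of `A`. -/
def IsEdgeColoring {φ : DiagonalExpectation A} (𝓔 : EdgeFamily φ I) (part : Edge I → Λ)
    (c : Λ → ℕ) : Prop :=
  ∀ l₁ l₂ : Λ,
    (∃ e₁ e₂ : Edge I, part e₁ = l₁ ∧ part e₂ = l₂ ∧ e₁.range = e₂.range ∧
      ∃ T : A →ₐ[ℂ] Matrix (Fin 3) (Fin 3) ℂ, IsCCRep A T ∧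
        ∀ a, T a =
          !![e₁.range (φ.toLin a), 𝓔.functional e₁ a, 𝓔.functional e₂ a;
             0, e₁.source (φ.toLin a), 0;
             0, 0, e₂.source (φ.toLin a)]) →
    c l₁ ≠ c l₂

/-- There is an edge colouring that uses at most `k` colours. -/
def IsColorable {φ : DiagonalExpectation A} (𝓔 : EdgeFamily φ I) (part : Edge I → Λ)
    (k : ℕ) : Prop :=
  ∃ c : Λ → ℕ, IsEdgeColoring 𝓔 part c ∧ (Set.range c).encard ≤ k

end Graph

/-! ## Direct sums of operators -/

section DirectSum

variable {ι : Type v} {H : ι → Type u} [∀ i, NormedAddCommGroup (H i)]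
  [∀ i, InnerProductSpace ℂ (H i)]

lemma norm_apply_le_smul (T : ∀ i, H i →L[ℂ] H i) {C : ℝ} (hC : 0 ≤ C) (hT : ∀ i, ‖T i‖ ≤ C)
    (x : lp H 2) (i : ι) : ‖T i (x i)‖ ≤ ‖((C : ℂ) • x) i‖ := by
  rw [lp.coeFn_smul, Pi.smul_apply, norm_smul, Complex.norm_real, Real.norm_of_nonneg hC]
  exact (T i).le_of_opNorm_le (hT i) (x i)

/-- The direct sum of a uniformly bounded family of operators, on the Hilbert sum of the spaces. -/
def directSum (T : ∀ i, H i →L[ℂ] H i) (C : ℝ) (hC : 0 ≤ C) (hT : ∀ i, ‖T i‖ ≤ C) :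
    lp H 2 →L[ℂ] lp H 2 :=
  LinearMap.mkContinuous
    { toFun := fun x => ⟨fun i => T i (x i),
        (lp.memℓp ((C : ℂ) • x)).mono' (norm_apply_le_smul T hC hT x)⟩
      map_add' := fun x y => by
        ext i
        exact map_add (T i) (x i) (y i)
      map_smul' := fun c x => by
        ext i
        exact map_smul (T i) c (x i) }
    C (fun x => by
      refine (lp.norm_mono two_ne_zero (norm_apply_le_smul T hC hT x)).trans ?_
      rw [norm_smul, Complex.norm_real, Real.norm_of_nonneg hC])

@[simp]
lemma directSum_apply (T : ∀ i, H i →L[ℂ] H i) (C : ℝ) (hC : 0 ≤ C) (hT : ∀ i, ‖T i‖ ≤ C)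
    (x : lp H 2) (i : ι) : directSum T C hC hT x i = T i (x i) := rfl

end DirectSum

/-! ## Semicrossed products and tensor algebras of multivariable dynamical systems

A multivariable dynamical system is a compact Hausdorff space `X` with finitely many continuous
maps `σ i : X → X`; equivalently, `C(X)` with the unital `*`-endomorphisms `f ↦ f ∘ σ i`. -/

/-- A contractive covariant representation of the system `(X, σ)` on a Hilbert space. -/
structure CovariantRep {X : Type u} [TopologicalSpace X] [CompactSpace X] {n : ℕ}
    (σ : Fin n → C(X, X)) where
  H : Type u
  [instNormed : NormedAddCommGroup H]
  [instInner : InnerProductSpace ℂ H]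
  [instComplete : CompleteSpace H]
  ρ : C(X, ℂ) →⋆ₐ[ℂ] (H →L[ℂ] H)
  S : Fin n → (H →L[ℂ] H)
  contractive : ∀ i, ‖S i‖ ≤ 1
  covariant : ∀ (i : Fin n) (f : C(X, ℂ)), ρ f * S i = S i * ρ (f.comp (σ i))

attribute [instance] CovariantRep.instNormed CovariantRep.instInner CovariantRep.instComplete

section Dynamics

variable {X : Type u} [TopologicalSpace X] [CompactSpace X] {n : ℕ} {σ : Fin n → C(X, X)}

/-- The row operator `[S 1, …, S n] : H ⊕ ⋯ ⊕ H → H` is a contraction, that is,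
`∑ i, S i * (S i)* ≤ 1`. (This implies that each `S i` is a contraction.) -/
def CovariantRep.IsRowContractive (r : CovariantRep σ) : Prop :=
  ∀ x : Fin n → r.H, ‖∑ i, r.S i (x i)‖ ^ 2 ≤ ∑ i, ‖x i‖ ^ 2

/-- The Hilbert sum of the spaces of all covariant representations in the class `R`. -/
abbrev UniversalSpace (R : Set (CovariantRep σ)) : Type (u + 1) :=
  lp (fun r : R => r.1.H) 2

/-- The universal image of `f ∈ C(X)` for the class `R`. -/
def universalFun (R : Set (CovariantRep σ)) (f : C(X, ℂ)) :
    UniversalSpace R →L[ℂ] UniversalSpace R :=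
  directSum (fun r : R => r.1.ρ f) ‖f‖ (norm_nonneg f)
    (fun r => NonUnitalStarAlgHom.norm_apply_le r.1.ρ f)

/-- The universal image of the `i`-th generator for the class `R`. -/
def universalGen (R : Set (CovariantRep σ)) (i : Fin n) :
    UniversalSpace R →L[ℂ] UniversalSpace R :=
  directSum (fun r : R => r.1.S i) 1 zero_le_one (fun r => r.1.contractive i)

/-- The universal operator algebra for the class `R`: the norm-closed algebra generated by the
universal images of `C(X)` and of the `n` generators. -/
def universalAlgebra (R : Set (CovariantRep σ)) :
    Subalgebra ℂ (UniversalSpace R →L[ℂ] UniversalSpace R) :=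
  (Algebra.adjoin ℂ
    (Set.range (universalFun R) ∪ Set.range (universalGen R))).topologicalClosure

lemma universalFun_mem (R : Set (CovariantRep σ)) (f : C(X, ℂ)) :
    universalFun R f ∈ universalAlgebra R :=
  Subalgebra.le_topologicalClosure _ (Algebra.subset_adjoin (Or.inl ⟨f, rfl⟩))

lemma universalGen_mem (R : Set (CovariantRep σ)) (i : Fin n) :
    universalGen R i ∈ universalAlgebra R :=
  Subalgebra.le_topologicalClosure _ (Algebra.subset_adjoin (Or.inr ⟨i, rfl⟩))

/-- The `i`-th generator, as an element of the universal algebra. -/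
def gen (R : Set (CovariantRep σ)) (i : Fin n) : universalAlgebra R :=
  ⟨universalGen R i, universalGen_mem R i⟩

lemma universalFun_star (R : Set (CovariantRep σ)) (f : C(X, ℂ)) :
    universalFun R (star f) = star (universalFun R f) := by
  rw [ContinuousLinearMap.star_eq_adjoint, ContinuousLinearMap.eq_adjoint_iff]
  intro x y
  rw [lp.inner_eq_tsum, lp.inner_eq_tsum]
  refine tsum_congr fun r => ?_
  change inner ℂ (r.1.ρ (star f) (x r)) (y r) = inner ℂ (x r) (r.1.ρ f (y r))
  rw [map_star, ContinuousLinearMap.star_eq_adjoint, ContinuousLinearMap.adjoint_inner_left]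

/-- The canonical `*`-homomorphism from `C(X)` to the diagonal of the universal algebra. -/
def universalHom (R : Set (CovariantRep σ)) :
    C(X, ℂ) →⋆ₐ[ℂ] diagonal (universalAlgebra R) where
  toFun f := ⟨universalFun R f, universalFun_mem R f, by
    rw [← universalFun_star]; exact universalFun_mem R (star f)⟩
  map_one' := by
    ext x r
    change r.1.ρ 1 (x r) = x r
    rw [map_one]; rfl
  map_mul' f g := by
    ext x r
    change r.1.ρ (f * g) (x r) = r.1.ρ f (r.1.ρ g (x r))
    rw [map_mul]; rfl
  map_zero' := by
    ext x r
    change r.1.ρ 0 (x r) = 0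
    rw [map_zero]; rfl
  map_add' f g := by
    ext x r
    change r.1.ρ (f + g) (x r) = r.1.ρ f (x r) + r.1.ρ g (x r)
    rw [map_add]; rfl
  commutes' c := by
    ext x r
    change r.1.ρ (algebraMap ℂ C(X, ℂ) c) (x r) = c • x r
    rw [AlgHomClass.commutes]; rfl
  map_star' f := by
    ext1
    exact universalFun_star R f

/-- The point of `X` that a vertex `v` of the universal algebra determines: the point `x` with
`v(f) = f(x)` for all `f ∈ C(X)`. -/
def basePoint [T2Space X] {R : Set (CovariantRep σ)} (v : Vertex (universalAlgebra R)) : X :=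
  (WeakDual.CharacterSpace.homeoEval X ℂ).symm
    (WeakDual.CharacterSpace.equivAlgHom.symm
      ((AlgHomClass.toAlgHom v).comp (universalHom R).toAlgHom))

lemma basePoint_spec [T2Space X] {R : Set (CovariantRep σ)} (v : Vertex (universalAlgebra R))
    (f : C(X, ℂ)) : v (universalHom R f) = f (basePoint v) := by
  have h := (WeakDual.CharacterSpace.homeoEval X ℂ).apply_symm_apply
    (WeakDual.CharacterSpace.equivAlgHom.symm
      ((AlgHomClass.toAlgHom v).comp (universalHom R).toAlgHom))
  exact (DFunLike.congr_fun h f).symm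

variable (σ)

/-- The semicrossed product `C(X) ⋊_σ 𝔽ₙ⁺`: the universal operator algebra for `C(X)` and
contractions `S i` with `f S i = S i (f ∘ σ i)`. -/
abbrev semicrossedProduct : Subalgebra ℂ
    (UniversalSpace (Set.univ : Set (CovariantRep σ)) →L[ℂ]
      UniversalSpace (Set.univ : Set (CovariantRep σ))) :=
  universalAlgebra Set.univ

/-- The tensor algebra `𝒜(X, σ)`: the universal operator algebra for `C(X)` and a row contraction
`[S 1, …, S n]` with `f S i = S i (f ∘ σ i)`. -/
abbrev tensorAlgebra : Subalgebra ℂ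
    (UniversalSpace {r : CovariantRep σ | r.IsRowContractive} →L[ℂ]
      UniversalSpace {r : CovariantRep σ | r.IsRowContractive}) :=
  universalAlgebra {r | r.IsRowContractive}

/-- Index set for the edges of the graph of the semicrossed product from `v` to `w`: the maps of
the system that send the point of `v` to the point of `w`. -/
def semicrossedIndex [T2Space X] (w v : Vertex (semicrossedProduct σ)) : Type :=
  {i : Fin n // σ i (basePoint v) = basePoint w}

/-- The partition of the edges of the semicrossed product by the maps `σ i`. -/
def semicrossedPart [T2Space X] (e : Edge (semicrossedIndex σ)) : Fin n := e.idx.1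

/-- The graph of the semicrossed product: `φ` is the canonical expectation, the homomorphism that
annihilates the generators `S i`; the edges from `v` to `w` are the classes in `E_{w,v}` of the
generators `S i` with `σ i (v) = w`; and the edges are partitioned by the index `i`. All data are
determined by these requirements. -/
structure SemicrossedGraph [T2Space X] where
  φ : DiagonalExpectation (semicrossedProduct σ)
  map_mul : ∀ a b, φ.toLin (a * b) = φ.toLin a * φ.toLin b
  map_gen : ∀ i, φ.toLin (gen Set.univ i) = 0
  edges : EdgeFamily φ (semicrossedIndex σ)
  basis_eq : ∀ w v (i : semicrossedIndex σ w v),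
    edges.basis w v i = φ.quot w v (gen Set.univ i.1)
  topological : IsTopologicalPartition (semicrossedPart σ)

/-- The edge-partitioned graph of the semicrossed product has an edge colouring with at most `k`
colours. -/
def SemicrossedGraph.Colorable [T2Space X] {σ : Fin n → C(X, X)} (G : SemicrossedGraph σ)
    (k : ℕ) : Prop :=
  IsColorable G.edges (semicrossedPart σ) k

end Dynamics

end OpAlg
end

/-! Write A for the semicrossed product. Existence of the graph. If `(ρ, S)` is a covariant
representation, so is `(ρ, s S)` for `|s| ≤ 1`, and the resulting representations of A depend
holomorphically on `s`. If `a` and `a*` both lie in A, then each matrix coefficient of `a` and its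
complex conjugate are holomorphic in `s`, hence constant; so the value at `s = 0`, which sees only
`C(X)`, equals the value at `s = 1`. Therefore `s = 0` defines an expectation that is multiplicative
and fixes `Δ(A)`, moreover `Δ(A) = C(X)` (`universalHom_surjective`), and the vertices are the
points of `X`. The corner `t` of a nest representation is a derivation that vanishes on `C(X)`, so
it is determined by the numbers `t(S_i)`, and covariance forces `t(S_i) = 0` unless `σ_i(v) = w`.
Conversely, each such `i` gives a representation in which `S_i` goes to a matrix unit and the other
generators go to zero. Hence the classes of these `S_i` are a basis. Colorable implies tensor
algebra. A point common to the ranges of `σ_i` and `σ_j`, `i ≠ j`, yields a `3 × 3` representation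
with `S_i`, `S_j` going to the matrix units in positions `(1,2)`, `(1,3)`: each is a contraction,
and nothing is asked of the row. So one color forces the ranges to be disjoint. Then the generators
have orthogonal ranges in every covariant representation, every covariant representation is row
contractive, and A is the tensor algebra of `(X, σ)` itself. Tensor algebra implies colorable. The
generators of a tensor algebra form a row contraction, hence so do their images in a `3 × 3`
representation from the definition of a coloring. One of its two corners uses at most half of the
available norm (`row_dichotomy`), so the corresponding `2 × 2` representation stays row contractive
when that corner is multiplied by `√2`. By universality it is then completely contractive, yet it
sends some `S_i` to a matrix with an entry `√2` (`not_row_of_edge`). So no such `3 × 3`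
representation exists and the constant coloring is admissible. -/

noncomputable section

namespace OpAlg

/-! ## Matrix norms -/

section MatrixNorms

variable {H : Type u} [NormedAddCommGroup H] [InnerProductSpace ℂ H]
variable {K : Type v} [NormedAddCommGroup K] [InnerProductSpace ℂ K]

lemma matOp_apply {k : ℕ} (M : Matrix (Fin k) (Fin k) (H →L[ℂ] H))
    (x : PiLp 2 (fun _ : Fin k => H)) (i : Fin k) : matOp M x i = ∑ j, M i j (x j) := by
  simp [matOp]

lemma norm_matOp_le_iff {k : ℕ} (M : Matrix (Fin k) (Fin k) (H →L[ℂ] H)) {C : ℝ} (hC : 0 ≤ C) :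
    ‖matOp M‖ ≤ C ↔
      ∀ x : Fin k → H, ∑ i, ‖∑ j, M i j (x j)‖ ^ 2 ≤ C ^ 2 * ∑ i, ‖x i‖ ^ 2 := by
  rw [ContinuousLinearMap.opNorm_le_iff hC]
  constructor
  · intro h x
    have := h (WithLp.toLp 2 x)
    rw [← sq_le_sq₀ (norm_nonneg _) (by positivity), mul_pow, PiLp.norm_sq_eq_of_L2,
      PiLp.norm_sq_eq_of_L2] at this
    simpa only [matOp_apply] using this
  · intro h x
    rw [← sq_le_sq₀ (norm_nonneg _) (by positivity), mul_pow, PiLp.norm_sq_eq_of_L2,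
      PiLp.norm_sq_eq_of_L2]
    simpa only [matOp_apply] using h x

lemma sum_norm_sq_le_matOp {k : ℕ} (M : Matrix (Fin k) (Fin k) (H →L[ℂ] H)) (x : Fin k → H) :
    ∑ i, ‖∑ j, M i j (x j)‖ ^ 2 ≤ ‖matOp M‖ ^ 2 * ∑ i, ‖x i‖ ^ 2 :=
  (norm_matOp_le_iff M (ContinuousLinearMap.opNorm_nonneg _)).1 le_rfl x

variable {A : Subalgebra ℂ (H →L[ℂ] H)}

/-- The form in which complete contractivity is checked and used: an estimate on tuples of vectors,
which can be summed over the blocks of a Hilbert sum. -/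
lemma isCompletelyContractive_iff (f : A →ₗ[ℂ] (K →L[ℂ] K)) :
    IsCompletelyContractive A f ↔ ∀ (k : ℕ) (M : Matrix (Fin k) (Fin k) A) (x : Fin k → K),
      ∑ i, ‖∑ j, f (M i j) (x j)‖ ^ 2 ≤
        ‖matOp (M.map fun a => (a : H →L[ℂ] H))‖ ^ 2 * ∑ i, ‖x i‖ ^ 2 :=
  forall₂_congr fun _ _ => norm_matOp_le_iff _ (ContinuousLinearMap.opNorm_nonneg _)

lemma IsCompletelyContractive.norm_le {f : A →ₗ[ℂ] (K →L[ℂ] K)}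
    (hf : IsCompletelyContractive A f) (a : A) : ‖f a‖ ≤ ‖a‖ := by
  have h1 : ‖matOp ((Matrix.of fun _ _ : Fin 1 => a).map fun a => (a : H →L[ℂ] H))‖ ≤ ‖a‖ := by
    refine (norm_matOp_le_iff _ (norm_nonneg a)).2 ?_
    intro x
    simp only [Matrix.map_apply, Matrix.of_apply, Finset.univ_unique, Finset.sum_singleton]
    rw [← mul_pow]
    gcongr
    exact (a : H →L[ℂ] H).le_opNorm _
  refine ContinuousLinearMap.opNorm_le_bound _ (norm_nonneg _) fun x => ?_
  have h2 := (isCompletelyContractive_iff f).1 hf 1 (Matrix.of fun _ _ => a) fun _ => x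
  simp only [Matrix.of_apply, Finset.univ_unique, Finset.sum_singleton] at h2
  rw [← mul_pow, sq_le_sq₀ (norm_nonneg _) (by positivity)] at h2
  exact h2.trans (mul_le_mul_of_nonneg_right h1 (norm_nonneg _))

/-- A completely contractive map sends row contractions to row contractions. -/
lemma IsCompletelyContractive.row {f : A →ₗ[ℂ] (K →L[ℂ] K)}
    (hf : IsCompletelyContractive A f) {m : ℕ} (a : Fin m → A)
    (ha : ∀ x : Fin m → H, ‖∑ j, (a j : H →L[ℂ] H) (x j)‖ ^ 2 ≤ ∑ j, ‖x j‖ ^ 2)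
    (x : Fin m → K) : ‖∑ j, f (a j) (x j)‖ ^ 2 ≤ ∑ j, ‖x j‖ ^ 2 := by
  obtain _ | m := m
  · simp
  -- Complete contractivity is phrased for square matrices, so the row becomes the first row of a
  -- square matrix padded with zeros; this needs `m > 0`.
  let M : Matrix (Fin (m + 1)) (Fin (m + 1)) A := Matrix.of fun i j => if i = 0 then a j else 0
  have hM : ‖matOp (M.map fun a => (a : H →L[ℂ] H))‖ ≤ 1 := by
    rw [norm_matOp_le_iff _ zero_le_one]
    intro x
    rw [Fin.sum_univ_succ]
    simpa [M] using ha x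
  have h := (isCompletelyContractive_iff f).1 hf _ M x
  rw [Fin.sum_univ_succ] at h
  simp only [M, Matrix.of_apply, if_true, Fin.succ_ne_zero, if_false, map_zero, zero_apply,
    Finset.sum_const_zero, norm_zero, ne_eq, OfNat.ofNat_ne_zero, not_false_eq_true, zero_pow,
    add_zero] at h
  refine h.trans (mul_le_of_le_one_left (by positivity) ?_)
  exact pow_le_one₀ (ContinuousLinearMap.opNorm_nonneg _) hM

end MatrixNorms

/-- The row operator `[S 1, …, S n]` is a contraction if and only if its adjoint is. -/
lemma row_contractive_iff {H : Type u} [NormedAddCommGroup H] [InnerProductSpace ℂ H]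
    [CompleteSpace H] {n : ℕ} (S : Fin n → (H →L[ℂ] H)) :
    (∀ x : Fin n → H, ‖∑ i, S i (x i)‖ ^ 2 ≤ ∑ i, ‖x i‖ ^ 2) ↔
      ∀ y : H, ∑ i, ‖star (S i) y‖ ^ 2 ≤ ‖y‖ ^ 2 := by
  have key : ∀ (x : Fin n → H) (y : H),
      ‖inner ℂ y (∑ i, S i (x i))‖ ≤ √(∑ i, ‖star (S i) y‖ ^ 2) * √(∑ i, ‖x i‖ ^ 2) := by
    intro x y
    rw [inner_sum]
    refine (norm_sum_le _ _).trans (le_trans (Finset.sum_le_sum fun i _ => ?_)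
      (Real.sum_mul_le_sqrt_mul_sqrt _ _ _))
    rw [← ContinuousLinearMap.adjoint_inner_left]
    exact norm_inner_le_norm _ _
  constructor
  · intro h y
    have h1 := h fun i => star (S i) y
    have h2 : ∑ i, ‖star (S i) y‖ ^ 2 = ‖inner ℂ y (∑ i, S i (star (S i) y))‖ := by
      rw [inner_sum]
      have : ∀ i, inner ℂ y (S i (star (S i) y)) = ((‖star (S i) y‖ ^ 2 : ℝ) : ℂ) := fun i => by
        rw [← ContinuousLinearMap.adjoint_inner_left, ← ContinuousLinearMap.star_eq_adjoint,
          inner_self_eq_norm_sq_to_K]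
        norm_cast
      simp_rw [this]
      rw [← Complex.ofReal_sum, Complex.norm_real, Real.norm_of_nonneg (by positivity)]
    set s := ∑ i, ‖star (S i) y‖ ^ 2
    have h3 : s ≤ ‖y‖ * ‖∑ i, S i (star (S i) y)‖ := h2.trans_le (norm_inner_le_norm _ _)
    have hs : 0 ≤ s := by positivity
    -- With `r = ‖∑ S_i S_i* y‖`: `2s ≤ 2‖y‖r ≤ ‖y‖² + r² ≤ ‖y‖² + s`, which avoids dividing by `r`.
    nlinarith [sq_nonneg (‖y‖ - ‖∑ i, S i (star (S i) y)‖)]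
  · intro h x
    have h1 := key x (∑ i, S i (x i))
    rw [inner_self_eq_norm_sq_to_K] at h1
    set y := ∑ i, S i (x i)
    have h2 : √(∑ i, ‖star (S i) y‖ ^ 2) ≤ ‖y‖ :=
      (Real.sqrt_le_sqrt (h y)).trans_eq (Real.sqrt_sq (norm_nonneg _))
    have h3 : ‖y‖ ^ 2 ≤ ‖y‖ * √(∑ i, ‖x i‖ ^ 2) := by
      refine le_trans ?_ (h1.trans (mul_le_mul_of_nonneg_right h2 (Real.sqrt_nonneg _)))
      norm_cast
      simp
    have h4 := Real.sq_sqrt (show 0 ≤ ∑ i, ‖x i‖ ^ 2 by positivity)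
    nlinarith [sq_nonneg (‖y‖ - √(∑ i, ‖x i‖ ^ 2))]

/-! ## Block diagonal operators -/

lemma lp_hasSum_norm_sq {ι : Type v} {H : ι → Type u} [∀ i, NormedAddCommGroup (H i)]
    (x : lp H 2) : HasSum (fun i => ‖x i‖ ^ 2) (‖x‖ ^ 2) := by
  simpa using lp.hasSum_norm (p := 2) (by simp) x

section BlockDiagonal

variable {ι : Type v} {H : ι → Type u} [∀ i, NormedAddCommGroup (H i)]
  [∀ i, InnerProductSpace ℂ (H i)]

/-- The algebra of block diagonal operators on a Hilbert sum. -/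
def blockDiagonal (H : ι → Type u) [∀ i, NormedAddCommGroup (H i)]
    [∀ i, InnerProductSpace ℂ (H i)] : Subalgebra ℂ (lp H 2 →L[ℂ] lp H 2) where
  carrier := {a | ∀ i x, x i = 0 → a x i = 0}
  mul_mem' := fun {a b} ha hb i x hx => ha i (b x) (hb i x hx)
  add_mem' := fun {a b} ha hb i x hx => by
    change a x i + b x i = 0
    rw [ha i x hx, hb i x hx, add_zero]
  algebraMap_mem' := fun c i x hx => by
    change c • x i = 0
    rw [hx, smul_zero]

lemma isClosed_blockDiagonal :
    IsClosed (blockDiagonal H : Set (lp H 2 →L[ℂ] lp H 2)) := by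
  have : (blockDiagonal H : Set (lp H 2 →L[ℂ] lp H 2)) =
      ⋂ (i) (x : lp H 2) (_ : x i = 0), {a | lp.evalCLM ℂ H 2 i (a x) = 0} := by
    ext a
    simp only [Set.mem_iInter]
    rfl
  rw [this]
  refine isClosed_iInter fun i => isClosed_iInter fun x => isClosed_iInter fun _ =>
    isClosed_eq (by fun_prop) continuous_const

lemma directSum_mem_blockDiagonal (T : ∀ i, H i →L[ℂ] H i) (C : ℝ) (hC : 0 ≤ C)
    (hT : ∀ i, ‖T i‖ ≤ C) : directSum T C hC hT ∈ blockDiagonal H := fun i x hx => by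
  rw [directSum_apply, hx, map_zero]

open Classical in
/-- The inclusion of the `i`-th summand in a Hilbert sum. -/
def inclusion (i : ι) : H i →L[ℂ] lp H 2 := lp.singleContinuousLinearMap ℂ H 2 i

open Classical in
lemma inclusion_same (i : ι) (x : H i) : inclusion i x i = x := lp.single_apply_self 2 i x

open Classical in
lemma inclusion_ne (i : ι) (x : H i) {j : ι} (hj : j ≠ i) : inclusion i x j = 0 :=
  lp.single_apply_ne 2 i x hj

open Classical in
lemma norm_inclusion (i : ι) (x : H i) : ‖inclusion i x‖ = ‖x‖ :=
  lp.norm_single (p := 2) (by simp) i x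

/-- The `i`-th diagonal block of an operator on a Hilbert sum. -/
def block (i : ι) (a : lp H 2 →L[ℂ] lp H 2) : H i →L[ℂ] H i :=
  lp.evalCLM ℂ H 2 i ∘L a ∘L inclusion i

/-- The vectors `x` and `inclusion i (x i)` agree in coordinate `i`, so their images under a block
diagonal operator do too. -/
lemma block_apply {a : lp H 2 →L[ℂ] lp H 2} (ha : a ∈ blockDiagonal H) (i : ι) (x : lp H 2) :
    block i a (x i) = a x i := by
  have h := ha i (inclusion i (x i) - x) (by
    rw [lp.coeFn_sub, Pi.sub_apply, inclusion_same, sub_self])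
  rw [map_sub, lp.coeFn_sub, Pi.sub_apply, sub_eq_zero] at h
  exact h

lemma apply_inclusion {a : lp H 2 →L[ℂ] lp H 2} (ha : a ∈ blockDiagonal H) (i : ι) (x : H i) :
    a (inclusion i x) = inclusion i (block i a x) := by
  ext j
  by_cases hj : j = i
  · subst hj
    rw [inclusion_same]; rfl
  · rw [inclusion_ne _ _ hj]
    exact ha j _ (inclusion_ne _ _ hj)

end BlockDiagonal

/-! ## Representations of the universal algebras -/

section Universal

variable {X : Type u} [TopologicalSpace X] [CompactSpace X] {n : ℕ} {σ : Fin n → C(X, X)}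
variable {R : Set (CovariantRep σ)}

/-- The image of `f ∈ C(X)`, as an element of the universal algebra. -/
def func (R : Set (CovariantRep σ)) (f : C(X, ℂ)) : universalAlgebra R :=
  ⟨universalFun R f, universalFun_mem R f⟩

lemma func_algebraMap (c : ℂ) : func R (algebraMap ℂ C(X, ℂ) c) = algebraMap ℂ _ c :=
  Subtype.ext (congrArg (fun a : diagonal (universalAlgebra R) => a.1)
    ((universalHom R).commutes' c))

lemma func_one : func R 1 = 1 := by simpa using func_algebraMap (R := R) 1

lemma universalFun_zero : universalFun R 0 = 0 :=
  congrArg (fun a : diagonal (universalAlgebra R) => a.1) (map_zero (universalHom R))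

lemma universalFun_add (f g : C(X, ℂ)) :
    universalFun R (f + g) = universalFun R f + universalFun R g :=
  congrArg (fun a : diagonal (universalAlgebra R) => a.1) (map_add (universalHom R) f g)

lemma universalFun_sub (f g : C(X, ℂ)) :
    universalFun R (f - g) = universalFun R f - universalFun R g :=
  congrArg (fun a : diagonal (universalAlgebra R) => a.1) (map_sub (universalHom R) f g)

lemma universalFun_mul (f g : C(X, ℂ)) :
    universalFun R (f * g) = universalFun R f * universalFun R g :=
  congrArg (fun a : diagonal (universalAlgebra R) => a.1) (map_mul (universalHom R) f g)

/-- Generated algebra first, then its closure. Scalars need no case of their own, being images of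
constant functions. -/
lemma universalAlgebra_induction {P : universalAlgebra R → Prop}
    (hfun : ∀ f, P (func R f)) (hgen : ∀ i, P (gen R i))
    (hadd : ∀ a b, P a → P b → P (a + b)) (hmul : ∀ a b, P a → P b → P (a * b))
    (hclosed : IsClosed {a | P a}) (a : universalAlgebra R) : P a := by
  have h1 : ∀ b (hb : b ∈ Algebra.adjoin ℂ
      (Set.range (universalFun R) ∪ Set.range (universalGen R))),
      P ⟨b, Subalgebra.le_topologicalClosure _ hb⟩ := by
    intro b hb
    induction hb using Algebra.adjoin_induction with
    | mem x hx =>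
      obtain ⟨f, rfl⟩ | ⟨i, rfl⟩ := hx
      · exact hfun f
      · exact hgen i
    | algebraMap c =>
      have := hfun (algebraMap ℂ C(X, ℂ) c)
      rwa [func_algebraMap] at this
    | add x y _ _ hx hy => exact hadd _ _ hx hy
    | mul x y _ _ hx hy => exact hmul _ _ hx hy
  have h2 : a ∈ closure {b : universalAlgebra R | b.1 ∈ Algebra.adjoin ℂ
      (Set.range (universalFun R) ∪ Set.range (universalGen R))} := by
    rw [closure_subtype]
    refine closure_mono (fun b hb => ?_) a.2
    exact ⟨⟨b, Subalgebra.le_topologicalClosure _ hb⟩, hb, rfl⟩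
  exact hclosed.closure_subset_iff.2 (fun b hb => h1 b.1 hb) h2

lemma universalAlgebra_hom_ext {B : Type v} [Ring B] [Algebra ℂ B] [TopologicalSpace B]
    [T2Space B] {f g : universalAlgebra R →ₐ[ℂ] B} (hf : Continuous f) (hg : Continuous g)
    (hfun : ∀ h, f (func R h) = g (func R h)) (hgen : ∀ i, f (gen R i) = g (gen R i)) :
    f = g := by
  ext a
  refine universalAlgebra_induction (P := fun a => f a = g a) hfun hgen ?_ ?_
    (isClosed_eq hf hg) a
  · intro a b ha hb
    rw [map_add, map_add, ha, hb]
  · intro a b ha hb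
    rw [map_mul, map_mul, ha, hb]

/-- This is what makes compression to a single summand multiplicative. -/
lemma universalAlgebra_le_blockDiagonal :
    universalAlgebra R ≤ blockDiagonal (fun r : R => r.1.H) := by
  refine Subalgebra.topologicalClosure_minimal (Algebra.adjoin_le ?_) isClosed_blockDiagonal
  rintro _ (⟨f, rfl⟩ | ⟨i, rfl⟩) <;> exact directSum_mem_blockDiagonal _ _ _ _

/-- The representation of the universal algebra determined by a covariant representation. -/
def component (r : R) : universalAlgebra R →ₐ[ℂ] (r.1.H →L[ℂ] r.1.H) where
  toFun a := block r (a : UniversalSpace R →L[ℂ] UniversalSpace R)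
  map_one' := by
    ext x
    exact inclusion_same (H := fun r : R => r.1.H) r x
  map_mul' a b := by
    ext x
    exact (block_apply (H := fun r : R => r.1.H) (universalAlgebra_le_blockDiagonal a.2) r
      (b.1 (inclusion (H := fun r : R => r.1.H) r x))).symm
  map_zero' := rfl
  map_add' a b := rfl
  commutes' c := by
    ext x
    exact congrArg (c • ·) (inclusion_same (H := fun r : R => r.1.H) r x)

lemma component_apply (r : R) (a : universalAlgebra R) (x : UniversalSpace R) :
    component r a (x r) = (a : UniversalSpace R →L[ℂ] UniversalSpace R) x r :=
  block_apply (H := fun r : R => r.1.H) (universalAlgebra_le_blockDiagonal a.2) r x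

lemma component_of_apply {r : R} {a : universalAlgebra R} {T : r.1.H →L[ℂ] r.1.H}
    (h : ∀ x : UniversalSpace R,
      (a : UniversalSpace R →L[ℂ] UniversalSpace R) x r = T (x r)) : component r a = T := by
  ext x
  have := component_apply r a (inclusion (H := fun r : R => r.1.H) r x)
  rwa [h, inclusion_same] at this

@[simp]
lemma component_func (r : R) (f : C(X, ℂ)) : component r (func R f) = r.1.ρ f :=
  component_of_apply fun _ => rfl

@[simp]
lemma component_gen (r : R) (i : Fin n) : component r (gen R i) = r.1.S i :=
  component_of_apply fun _ => rfl

/-- The isometric inclusion of the summand intertwines `component r a` with `a`. -/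
lemma component_completelyContractive (r : R) :
    IsCompletelyContractive (universalAlgebra R) (component r).toLinearMap := by
  rw [isCompletelyContractive_iff]
  intro k M x
  have h := sum_norm_sq_le_matOp (M.map fun a => (a : UniversalSpace R →L[ℂ] UniversalSpace R))
    fun j => inclusion (H := fun r : R => r.1.H) r (x j)
  have h1 : ∀ i j, (M i j : UniversalSpace R →L[ℂ] UniversalSpace R)
      (inclusion (H := fun r : R => r.1.H) r (x j)) =
      inclusion (H := fun r : R => r.1.H) r (component r (M i j) (x j)) := fun i j =>
    apply_inclusion (universalAlgebra_le_blockDiagonal (M i j).2) r (x j)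
  simp only [Matrix.map_apply, h1, ← map_sum, norm_inclusion] at h
  exact h

lemma continuous_of_norm_le {F : Type v} [SeminormedAddCommGroup F] [NormedSpace ℂ F]
    {A : Type w} [SeminormedAddCommGroup A] [NormedSpace ℂ A] (f : A →ₗ[ℂ] F)
    (hf : ∀ a, ‖f a‖ ≤ ‖a‖) : Continuous f :=
  (f.mkContinuous 1 (by simpa using hf)).continuous

lemma norm_component_le (r : R) (a : universalAlgebra R) : ‖component r a‖ ≤ ‖a‖ :=
  (component_completelyContractive r).norm_le a

lemma continuous_component (r : R) : Continuous (component r) :=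
  continuous_of_norm_le (component r).toLinearMap (norm_component_le r)

lemma component_ext {a b : universalAlgebra R} (h : ∀ r : R, component r a = component r b) :
    a = b := by
  ext x r
  rw [← component_apply, ← component_apply, h]

end Universal

/-! ## The expectation onto `C(X)` and the diagonal of the semicrossed product -/

section Expectation

variable {X : Type u} [TopologicalSpace X] [CompactSpace X] {n : ℕ} {σ : Fin n → C(X, X)}

/-- The covariant representation `(ρ, s S)`. -/
def CovariantRep.scale (r : CovariantRep σ) (s : ℂ) (hs : ‖s‖ ≤ 1) : CovariantRep σ where
  H := r.H
  ρ := r.ρ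
  S i := s • r.S i
  contractive i := by
    rw [norm_smul]
    exact mul_le_one₀ hs (norm_nonneg _) (r.contractive i)
  covariant i f := by
    rw [mul_smul_comm, smul_mul_assoc, r.covariant]

/-- The representation of the semicrossed product determined by `(ρ, s S)`. -/
def scaled (r : CovariantRep σ) (s : ℂ) (hs : ‖s‖ ≤ 1) :
    semicrossedProduct σ →ₐ[ℂ] (r.H →L[ℂ] r.H) :=
  component (R := Set.univ) ⟨r.scale s hs, trivial⟩

lemma scaled_func (r : CovariantRep σ) (s : ℂ) (hs : ‖s‖ ≤ 1) (f : C(X, ℂ)) :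
    scaled r s hs (func _ f) = r.ρ f := component_func _ f

lemma scaled_gen (r : CovariantRep σ) (s : ℂ) (hs : ‖s‖ ≤ 1) (i : Fin n) :
    scaled r s hs (gen _ i) = s • r.S i := component_gen _ i

lemma norm_scaled_le (r : CovariantRep σ) (s : ℂ) (hs : ‖s‖ ≤ 1) (a : semicrossedProduct σ) :
    ‖scaled r s hs a‖ ≤ ‖a‖ := norm_component_le _ a

lemma continuous_scaled (r : CovariantRep σ) (s : ℂ) (hs : ‖s‖ ≤ 1) :
    Continuous (scaled r s hs) := continuous_component _

/-- The rescaled representation at `s = 1` is not literally `r`, so the two are compared on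
generators. -/
lemma scaled_one (r : CovariantRep σ) (a : semicrossedProduct σ) :
    scaled r 1 norm_one.le a = component (R := Set.univ) ⟨r, trivial⟩ a := by
  let g : semicrossedProduct σ →ₐ[ℂ] (r.H →L[ℂ] r.H) :=
    component (R := Set.univ) ⟨r, trivial⟩
  have hg : Continuous g := continuous_component (R := Set.univ) ⟨r, trivial⟩
  have h1 : ∀ f, scaled r 1 norm_one.le (func _ f) = g (func _ f) := fun f => by
    rw [scaled_func]
    exact (component_func (R := Set.univ) ⟨r, trivial⟩ f).symm
  have h2 : ∀ i, scaled r 1 norm_one.le (gen _ i) = g (gen _ i) := fun i => by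
    rw [scaled_gen, one_smul]
    exact (component_gen (R := Set.univ) ⟨r, trivial⟩ i).symm
  have h := universalAlgebra_hom_ext (continuous_scaled r 1 norm_one.le) hg h1 h2
  exact DFunLike.congr_fun h a

/-- The compression of the semicrossed product to the representations `(ρ, 0)`. -/
def expectation (a : semicrossedProduct σ) :
    UniversalSpace (Set.univ : Set (CovariantRep σ)) →L[ℂ]
      UniversalSpace (Set.univ : Set (CovariantRep σ)) :=
  directSum (fun r => scaled r.1 0 (by simp) a) ‖a‖ (norm_nonneg a)
    fun r => norm_scaled_le _ _ _ a

lemma expectation_apply (a : semicrossedProduct σ)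
    (x : UniversalSpace (Set.univ : Set (CovariantRep σ))) (r : (Set.univ : Set (CovariantRep σ))) :
    expectation a x r = scaled r.1 0 (by simp) a (x r) := rfl

/-- The compression to the representations `(ρ, 0)`, as a homomorphism. -/
def expectationHom : semicrossedProduct σ →ₐ[ℂ]
    (UniversalSpace (Set.univ : Set (CovariantRep σ)) →L[ℂ]
      UniversalSpace (Set.univ : Set (CovariantRep σ))) where
  toFun := expectation
  map_one' := by
    ext x r
    rw [expectation_apply, map_one]; rfl
  map_mul' a b := by
    ext x r
    rw [expectation_apply, map_mul]; rfl
  map_zero' := by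
    ext x r
    rw [expectation_apply, map_zero]; rfl
  map_add' a b := by
    ext x r
    rw [expectation_apply, map_add]; rfl
  commutes' c := by
    ext x r
    rw [expectation_apply, AlgHomClass.commutes]; rfl

/-- Squared norms on the Hilbert sum are sums over the representations `r`, and the `r`-th term is
bounded because `(ρ, 0)` is itself one of the representations defining the algebra. -/
lemma expectationHom_completelyContractive :
    IsCompletelyContractive (semicrossedProduct σ) expectationHom.toLinearMap := by
  rw [isCompletelyContractive_iff]
  intro k M x
  set C := ‖matOp (M.map fun a => (a : UniversalSpace (Set.univ : Set (CovariantRep σ)) →L[ℂ]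
      UniversalSpace (Set.univ : Set (CovariantRep σ))))‖ with hC
  have h1 : HasSum (fun r : (Set.univ : Set (CovariantRep σ)) =>
      ∑ i, ‖∑ j, scaled r.1 0 (by simp) (M i j) (x j r)‖ ^ 2)
      (∑ i, ‖∑ j, expectation (M i j) (x j)‖ ^ 2) := by
    refine hasSum_sum fun i _ => ?_
    convert lp_hasSum_norm_sq (∑ j, expectation (M i j) (x j)) using 4 with r
    rw [lp.coeFn_sum, Finset.sum_apply]
    rfl
  have h2 : HasSum (fun r : (Set.univ : Set (CovariantRep σ)) => C ^ 2 * ∑ i, ‖x i r‖ ^ 2)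
      (C ^ 2 * ∑ i, ‖x i‖ ^ 2) :=
    (hasSum_sum fun i _ => lp_hasSum_norm_sq (x i)).mul_left _
  refine hasSum_le (fun r => ?_) h1 h2
  exact (isCompletelyContractive_iff _).1 (component_completelyContractive (R := Set.univ)
    ⟨r.1.scale 0 (by simp), trivial⟩) k M fun j => x j r

end Expectation

/-! ## Matrix representations -/

lemma exists_continuousMap_separating {X : Type u} [TopologicalSpace X] [CompactSpace X]
    [T2Space X] {x : X} {s : Set X} (hs : IsClosed s) (h : x ∉ s) :
    ∃ f : C(X, ℂ), f x = 0 ∧ ∀ y ∈ s, f y = 1 := by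
  obtain ⟨f, hf0, hf1, -⟩ := exists_continuous_zero_one_of_isClosed
    (isClosed_singleton (x := x)) hs (by simpa using h)
  refine ⟨⟨fun y => f y, by fun_prop⟩, ?_, fun y hy => ?_⟩
  · simpa using hf0 rfl
  · simpa using hf1 hy

lemma eq_of_continuousMap_eq {X : Type u} [TopologicalSpace X] [CompactSpace X]
    [T2Space X] {x y : X} (h : ∀ f : C(X, ℂ), f x = f y) : x = y := by
  by_contra hne
  obtain ⟨f, hf0, hf1⟩ := exists_continuousMap_separating (isClosed_singleton (x := y)) hne
  exact zero_ne_one (hf0.symm.trans ((h f).trans (hf1 y rfl)))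

section MatrixReps

/-- The space `ℂ^p`, in an arbitrary universe. -/
abbrev LiftedSpace (p : ℕ) : Type u := EuclideanSpace ℂ (ULift.{u} (Fin p))

/-- The identification of `ℂ^p` with its copy in another universe. -/
def liftSpace (p : ℕ) : EuclideanSpace ℂ (Fin p) ≃ₗᵢ[ℂ] LiftedSpace.{u} p :=
  LinearIsometryEquiv.piLpCongrLeft 2 ℂ ℂ Equiv.ulift.symm

/-- Matrices as operators on the copy of `ℂ^p` in another universe. -/
def matrixHom (p : ℕ) :
    Matrix (Fin p) (Fin p) ℂ ≃⋆ₐ[ℂ] (LiftedSpace.{u} p →L[ℂ] LiftedSpace.{u} p) :=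
  (Matrix.toEuclideanCLM (n := Fin p) (𝕜 := ℂ)).trans (liftSpace p).conjStarAlgEquiv

lemma matrixHom_apply {p : ℕ} (M : Matrix (Fin p) (Fin p) ℂ) (x : LiftedSpace.{u} p) :
    matrixHom p M x =
      liftSpace p (Matrix.toEuclideanCLM (n := Fin p) (𝕜 := ℂ) M ((liftSpace p).symm x)) := rfl

lemma norm_matrixHom_le {p : ℕ} (M : Matrix (Fin p) (Fin p) ℂ) :
    ‖matrixHom.{u} p M‖ ≤ ‖Matrix.toEuclideanCLM (n := Fin p) (𝕜 := ℂ) M‖ := by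
  refine ContinuousLinearMap.opNorm_le_bound _ (norm_nonneg _) fun x => ?_
  rw [matrixHom_apply, LinearIsometryEquiv.norm_map]
  refine (ContinuousLinearMap.le_opNorm _ _).trans_eq ?_
  rw [LinearIsometryEquiv.norm_map]

lemma toEuclideanCLM_apply {p : ℕ} (M : Matrix (Fin p) (Fin p) ℂ) (x : EuclideanSpace ℂ (Fin p))
    (k : Fin p) :
    Matrix.toEuclideanCLM (n := Fin p) (𝕜 := ℂ) M x k = ∑ l, M k l * x l := rfl

/-- Row `k` of `M` is, up to conjugation, the vector `M* e_k`. -/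
lemma norm_row_le {p : ℕ} (M : Matrix (Fin p) (Fin p) ℂ) (k : Fin p) :
    ∑ l, ‖M k l‖ ^ 2 ≤ ‖Matrix.toEuclideanCLM (n := Fin p) (𝕜 := ℂ) M‖ ^ 2 := by
  have h1 := ContinuousLinearMap.le_opNorm (Matrix.toEuclideanCLM (n := Fin p) (𝕜 := ℂ) (star M))
    (EuclideanSpace.single k 1)
  rw [map_star, ContinuousLinearMap.star_eq_adjoint,
    LinearIsometryEquiv.norm_map, PiLp.norm_single, norm_one, mul_one,
    ← sq_le_sq₀ (norm_nonneg _) (norm_nonneg _),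
    ← ContinuousLinearMap.star_eq_adjoint, ← map_star, EuclideanSpace.norm_sq_eq] at h1
  refine le_trans (le_of_eq (Finset.sum_congr rfl fun l _ => ?_)) h1
  rw [toEuclideanCLM_apply, Finset.sum_eq_single k]
  · simp [Matrix.star_apply]
  · intro j _ hj
    simp [hj]
  · simp

lemma norm_entry_le {p : ℕ} (M : Matrix (Fin p) (Fin p) ℂ) (k l : Fin p) :
    ‖M k l‖ ≤ ‖Matrix.toEuclideanCLM (n := Fin p) (𝕜 := ℂ) M‖ := by
  rw [← sq_le_sq₀ (norm_nonneg _) (norm_nonneg _)]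
  exact (Finset.single_le_sum (f := fun l => ‖M k l‖ ^ 2) (fun _ _ => by positivity)
    (Finset.mem_univ l)).trans (norm_row_le M k)

variable {H : Type u} [NormedAddCommGroup H] [InnerProductSpace ℂ H]
  {A : Subalgebra ℂ (H →L[ℂ] H)}

lemma IsCCRep.norm_le {p : ℕ} {T : A →ₐ[ℂ] Matrix (Fin p) (Fin p) ℂ} (hT : IsCCRep A T) (a : A) :
    ‖Matrix.toEuclideanCLM (n := Fin p) (𝕜 := ℂ) (T a)‖ ≤ ‖a‖ :=
  IsCompletelyContractive.norm_le hT a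

lemma IsCCRep.continuous {p : ℕ} {T : A →ₐ[ℂ] Matrix (Fin p) (Fin p) ℂ} (hT : IsCCRep A T) :
    Continuous T := by
  refine continuous_matrix fun k l => ?_
  exact continuous_of_norm_le ((LinearMap.proj l : (Fin p → ℂ) →ₗ[ℂ] ℂ) ∘ₗ
    (LinearMap.proj k : (Fin p → Fin p → ℂ) →ₗ[ℂ] _) ∘ₗ T.toLinearMap)
    fun a => (norm_entry_le (T a) k l).trans (hT.norm_le a)

variable {X : Type u} [TopologicalSpace X] [CompactSpace X] {n : ℕ} {σ : Fin n → C(X, X)}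

/-- The diagonal representation of `C(X)` at finitely many points. -/
def diagonalHom {X : Type u} [TopologicalSpace X] {p : ℕ} (x : Fin p → X) : C(X, ℂ) →⋆ₐ[ℂ] Matrix (Fin p) (Fin p) ℂ where
  toFun f := Matrix.diagonal fun k => f (x k)
  map_one' := Matrix.diagonal_one
  map_mul' f g := by simp
  map_zero' := Matrix.diagonal_zero
  map_add' f g := by simp
  commutes' c := rfl
  map_star' f := by
    rw [Matrix.star_eq_conjTranspose, Matrix.diagonal_conjTranspose]
    rfl

/-- The covariant representation on `ℂ^p` in which `C(X)` acts diagonally by evaluation at finitely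
many points. -/
def matrixRep {p : ℕ} (x : Fin p → X) (S : Fin n → Matrix (Fin p) (Fin p) ℂ)
    (hS : ∀ i, ‖Matrix.toEuclideanCLM (n := Fin p) (𝕜 := ℂ) (S i)‖ ≤ 1)
    (hc : ∀ i k l, S i k l ≠ 0 → x k = σ i (x l)) : CovariantRep σ where
  H := LiftedSpace.{u} p
  ρ := (matrixHom.{u} p : _ →⋆ₐ[ℂ] _).comp (diagonalHom x)
  S i := matrixHom.{u} p (S i)
  contractive i := (norm_matrixHom_le _).trans (hS i)
  covariant i f := by
    change matrixHom.{u} p _ * matrixHom.{u} p _ = matrixHom.{u} p _ * matrixHom.{u} p _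
    rw [← map_mul, ← map_mul]
    refine congrArg (matrixHom.{u} p) ?_
    change (Matrix.diagonal fun k => f (x k)) * S i =
      S i * Matrix.diagonal fun k => f.comp (σ i) (x k)
    ext k l
    rw [Matrix.diagonal_mul, Matrix.mul_diagonal]
    -- Entry `(k, l)` of the covariance relation reads `f(x_k) S_kl = S_kl f(σ_i(x_l))`.
    by_cases h : S i k l = 0
    · simp [h]
    · rw [hc i k l h, mul_comm]
      rfl

section

variable {R : Set (CovariantRep σ)} {p : ℕ} {x : Fin p → X} {S : Fin n → Matrix (Fin p) (Fin p) ℂ}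
  {hS : ∀ i, ‖Matrix.toEuclideanCLM (n := Fin p) (𝕜 := ℂ) (S i)‖ ≤ 1}
  {hc : ∀ i k l, S i k l ≠ 0 → x k = σ i (x l)}

/-- The representation of the universal algebra on the copy of `ℂ^p` determined by a covariant
representation by matrices. -/
def liftedComponent (hR : matrixRep x S hS hc ∈ R) :
    universalAlgebra R →ₐ[ℂ] (LiftedSpace.{u} p →L[ℂ] LiftedSpace.{u} p) :=
  component ⟨matrixRep x S hS hc, hR⟩

lemma liftedComponent_func (hR : matrixRep x S hS hc ∈ R) (f : C(X, ℂ)) :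
    liftedComponent hR (func R f) = matrixHom.{u} p (Matrix.diagonal fun k => f (x k)) :=
  component_func ⟨matrixRep x S hS hc, hR⟩ f

lemma liftedComponent_gen (hR : matrixRep x S hS hc ∈ R) (i : Fin n) :
    liftedComponent hR (gen R i) = matrixHom.{u} p (S i) :=
  component_gen ⟨matrixRep x S hS hc, hR⟩ i

lemma liftedComponent_completelyContractive (hR : matrixRep x S hS hc ∈ R) :
    IsCompletelyContractive (universalAlgebra R) (liftedComponent hR).toLinearMap :=
  component_completelyContractive ⟨matrixRep x S hS hc, hR⟩

/-- The representation by matrices of the universal algebra determined by a covariant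
representation on `ℂ^p`. -/
def matrixComponent (hR : matrixRep x S hS hc ∈ R) :
    universalAlgebra R →ₐ[ℂ] Matrix (Fin p) (Fin p) ℂ :=
  (AlgHomClass.toAlgHom (matrixHom.{u} p).symm).comp (liftedComponent hR)

lemma matrixHom_matrixComponent (hR : matrixRep x S hS hc ∈ R) (a : universalAlgebra R) :
    matrixHom.{u} p (matrixComponent hR a) = liftedComponent hR a :=
  (matrixHom.{u} p).apply_symm_apply _

lemma matrixComponent_func (hR : matrixRep x S hS hc ∈ R) (f : C(X, ℂ)) :
    matrixComponent hR (func R f) = Matrix.diagonal fun k => f (x k) := by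
  refine EquivLike.injective (matrixHom.{u} p) ?_
  rw [matrixHom_matrixComponent, liftedComponent_func]

lemma matrixComponent_gen (hR : matrixRep x S hS hc ∈ R) (i : Fin n) :
    matrixComponent hR (gen R i) = S i := by
  refine EquivLike.injective (matrixHom.{u} p) ?_
  rw [matrixHom_matrixComponent, liftedComponent_gen]

lemma matrixComponent_isCCRep (hR : matrixRep x S hS hc ∈ R) :
    IsCCRep (universalAlgebra R) (matrixComponent hR) := by
  refine (isCompletelyContractive_iff _).2 fun k M y => ?_
  have h := (isCompletelyContractive_iff _).1
    (liftedComponent_completelyContractive hR) k M fun j => liftSpace.{u} p (y j)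
  have h1 : ∀ i, ‖∑ j, (liftedComponent hR).toLinearMap (M i j) (liftSpace.{u} p (y j))‖ =
      ‖∑ j, Matrix.toEuclideanCLM (n := Fin p) (𝕜 := ℂ) (matrixComponent hR (M i j)) (y j)‖ := by
    intro i
    rw [← (liftSpace.{u} p).norm_map, map_sum]
    refine congrArg norm (Finset.sum_congr rfl fun j _ => ?_)
    change liftedComponent hR (M i j) _ = _
    rw [← matrixHom_matrixComponent, matrixHom_apply, LinearIsometryEquiv.symm_apply_apply]
  have h2 : ∀ j, ‖liftSpace.{u} p (y j)‖ = ‖y j‖ := fun j => LinearIsometryEquiv.norm_map _ _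
  simp only [h1, h2] at h
  exact h

/-- Through this uniqueness a merely continuous homomorphism with the right values on generators is
seen to be completely contractive. -/
lemma eq_matrixComponent (hR : matrixRep x S hS hc ∈ R)
    {Φ : universalAlgebra R →ₐ[ℂ] Matrix (Fin p) (Fin p) ℂ} (hΦ : Continuous Φ)
    (hf : ∀ f, Φ (func R f) = Matrix.diagonal fun k => f (x k)) (hg : ∀ i, Φ (gen R i) = S i) :
    Φ = matrixComponent hR :=
  universalAlgebra_hom_ext hΦ (matrixComponent_isCCRep hR).continuous
    (fun f => by rw [hf, matrixComponent_func]) (fun i => by rw [hg, matrixComponent_gen])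

end

/-- The covariance relation for a homomorphism of the universal algebra. -/
lemma func_mul_gen {R : Set (CovariantRep σ)} (f : C(X, ℂ)) (i : Fin n) :
    func R f * gen R i = gen R i * func R (f.comp (σ i)) := by
  refine component_ext fun r => ?_
  rw [map_mul, map_mul, component_func, component_func, component_gen, r.1.covariant]

/-- Otherwise a function that vanishes at `x k` and is one at `σ i (x l)`, put into the covariance
relation, kills the entry. -/
lemma point_eq_of_covariant [T2Space X] {R : Set (CovariantRep σ)} {p : ℕ} {x : Fin p → X}
    {Φ : universalAlgebra R →ₐ[ℂ] Matrix (Fin p) (Fin p) ℂ}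
    (hf : ∀ f, Φ (func R f) = Matrix.diagonal fun k => f (x k)) (i : Fin n) (k l : Fin p)
    (h : Φ (gen R i) k l ≠ 0) : x k = σ i (x l) := by
  by_contra hne
  obtain ⟨g, h2, h3⟩ := exists_continuousMap_separating (isClosed_singleton (x := σ i (x l))) hne
  have h1 := congrArg (fun a => Φ a k l) (func_mul_gen (R := R) g i)
  simp only [map_mul, hf, Matrix.diagonal_mul, Matrix.mul_diagonal] at h1
  rw [h2, ContinuousMap.comp_apply, h3 _ rfl, zero_mul, mul_one] at h1
  exact h h1.symm

end MatrixReps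

/-! ### Holomorphy in the scaling parameter and the identity `Δ(A) = C(X)` -/

lemma inner_inclusion_left {ι : Type v} {H : ι → Type u} [∀ i, NormedAddCommGroup (H i)]
    [∀ i, InnerProductSpace ℂ (H i)] (i : ι) (x : H i) (y : lp H 2) :
    inner ℂ (inclusion i x) y = inner ℂ x (y i) := by
  classical
  rw [lp.inner_eq_tsum, tsum_eq_single i, inclusion_same]
  intro j hj
  rw [inclusion_ne i x hj, inner_zero_left]

lemma inner_inclusion_right {ι : Type v} {H : ι → Type u} [∀ i, NormedAddCommGroup (H i)]
    [∀ i, InnerProductSpace ℂ (H i)] (i : ι) (x : lp H 2) (y : H i) :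
    inner ℂ x (inclusion i y) = inner ℂ (x i) y := by
  rw [← inner_conj_symm, inner_inclusion_left, inner_conj_symm]

/-- A holomorphic function on the disc with real values is constant. -/
lemma eq_of_im_eq_zero {g : ℂ → ℂ} (hg : DiffContOnCl ℂ g (Metric.ball 0 1))
    (him : ∀ s ∈ Metric.ball (0 : ℂ) 1, (g s).im = 0) : g 1 = g 0 := by
  have h0 : (0 : ℂ) ∈ Metric.ball (0 : ℂ) 1 := by simp
  obtain ⟨c, hc⟩ | hopen :=
    (hg.differentiableOn.analyticOnNhd Metric.isOpen_ball).is_constant_or_isOpen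
      (convex_ball (0 : ℂ) 1).isPreconnected
  · have h1 : Set.EqOn g (fun _ => c) (closure (Metric.ball 0 1)) :=
      Set.EqOn.of_subset_closure hc hg.continuousOn continuousOn_const subset_closure subset_rfl
    rw [hc 0 h0, h1 (by rw [closure_ball _ one_ne_zero]; simp)]
  · exfalso
    have h1 := hopen _ subset_rfl Metric.isOpen_ball
    obtain ⟨ε, hε, h2⟩ := Metric.isOpen_iff.1 h1 (g 0) ⟨0, h0, rfl⟩
    -- If the image of the disc were open, it would contain a point slightly above the real number
    -- `g 0`.
    obtain ⟨s, hs, h3⟩ := h2 (show g 0 + (ε / 2 : ℝ) * Complex.I ∈ _ by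
      simp only [Metric.mem_ball, dist_self_add_left, norm_mul, Complex.norm_I, mul_one,
        Complex.norm_real, Real.norm_of_nonneg (half_pos hε).le]
      exact half_lt_self hε)
    have h4 := him s hs
    rw [h3] at h4
    simp [him 0 h0, hε.ne'] at h4

lemma directSum_norm_le {ι : Type v} {H : ι → Type u} [∀ i, NormedAddCommGroup (H i)]
    [∀ i, InnerProductSpace ℂ (H i)] (T : ∀ i, H i →L[ℂ] H i) (C : ℝ) (hC : 0 ≤ C)
    (hT : ∀ i, ‖T i‖ ≤ C) : ‖directSum T C hC hT‖ ≤ C :=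
  LinearMap.mkContinuous_norm_le _ hC _

section Semicrossed

variable {X : Type u} [TopologicalSpace X] [CompactSpace X] {n : ℕ} {σ : Fin n → C(X, X)}

/-- Pairing with vectors supported in one summand shows that the block of an adjoint is the adjoint
of the block. -/
lemma component_star {R : Set (CovariantRep σ)} (r : R) {a b : universalAlgebra R}
    (h : (b : UniversalSpace R →L[ℂ] UniversalSpace R) = star a.1) (x y : r.1.H) :
    inner ℂ (component r a x) y = inner ℂ x (component r b y) := by
  have h1 : component r a x = a.1 (inclusion (H := fun r : R => r.1.H) r x) r := rfl
  have h2 : component r b y = b.1 (inclusion (H := fun r : R => r.1.H) r y) r := rfl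
  rw [h1, h2, ← inner_inclusion_right (H := fun r : R => r.1.H), h,
    ← inner_inclusion_left (H := fun r : R => r.1.H), ContinuousLinearMap.star_eq_adjoint,
    ContinuousLinearMap.adjoint_inner_right]

open Classical in
/-- The representations `(ρ, s S)` as a function of `s` in the unit disc. -/
def scaledFun (r : CovariantRep σ) (a : semicrossedProduct σ) (s : ℂ) : r.H →L[ℂ] r.H :=
  if h : ‖s‖ ≤ 1 then scaled r s h a else 0

lemma scaledFun_of_le (r : CovariantRep σ) (a : semicrossedProduct σ) {s : ℂ} (h : ‖s‖ ≤ 1) :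
    scaledFun r a s = scaled r s h a := dif_pos h

lemma dist_scaledFun_le (r : CovariantRep σ) (a b : semicrossedProduct σ) (s : ℂ) :
    dist (scaledFun r a s) (scaledFun r b s) ≤ dist a b := by
  by_cases h : ‖s‖ ≤ 1
  · rw [scaledFun_of_le r a h, scaledFun_of_le r b h, dist_eq_norm, dist_eq_norm, ← map_sub]
    exact norm_scaled_le _ _ _ _
  · rw [scaledFun, scaledFun, dif_neg h, dif_neg h, dist_self]
    exact dist_nonneg

lemma diffContOnCl_congr {F : Type v} [NormedAddCommGroup F] [NormedSpace ℂ F] {f g : ℂ → F}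
    (hf : DiffContOnCl ℂ f (Metric.ball 0 1)) (h : ∀ s : ℂ, ‖s‖ ≤ 1 → g s = f s) :
    DiffContOnCl ℂ g (Metric.ball 0 1) := by
  refine ⟨hf.differentiableOn.congr fun s hs => h s (mem_ball_zero_iff.1 hs).le,
    hf.continuousOn.congr fun s hs => h s ?_⟩
  rwa [closure_ball _ one_ne_zero, mem_closedBall_zero_iff] at hs

/-- The dependence on `s` is constant on `C(X)` and linear on the generators. Sums and products
preserve holomorphy, and so do norm limits in the algebra, since they become uniform limits in `s`.
-/
lemma diffContOnCl_scaledFun (r : CovariantRep σ) (a : semicrossedProduct σ) :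
    DiffContOnCl ℂ (scaledFun r a) (Metric.ball 0 1) := by
  refine universalAlgebra_induction
    (P := fun a => DiffContOnCl ℂ (scaledFun r a) (Metric.ball 0 1)) ?_ ?_ ?_ ?_ ?_ a
  · intro f
    refine diffContOnCl_congr (f := fun _ => r.ρ f) diffContOnCl_const fun s hs => ?_
    rw [scaledFun_of_le _ _ hs, scaled_func]
  · intro i
    refine diffContOnCl_congr (f := fun s => s • r.S i)
      (Differentiable.diffContOnCl (by fun_prop)) fun s hs => ?_
    rw [scaledFun_of_le _ _ hs, scaled_gen]
  · intro a b ha hb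
    refine diffContOnCl_congr (ha.add hb) fun s hs => ?_
    rw [scaledFun_of_le _ _ hs, map_add, Pi.add_apply, scaledFun_of_le _ _ hs,
      scaledFun_of_le _ _ hs]
  · intro a b ha hb
    refine diffContOnCl_congr (f := fun s => scaledFun r a s * scaledFun r b s)
      ⟨ha.differentiableOn.mul hb.differentiableOn, ha.continuousOn.mul hb.continuousOn⟩
      fun s hs => ?_
    rw [scaledFun_of_le _ _ hs, map_mul, scaledFun_of_le _ _ hs, scaledFun_of_le _ _ hs]
  · refine IsSeqClosed.isClosed fun u a hu hua => ?_
    have h1 : TendstoUniformly (fun k => scaledFun r (u k)) (scaledFun r a) Filter.atTop := by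
      rw [Metric.tendstoUniformly_iff]
      intro ε hε
      filter_upwards [Metric.tendsto_nhds.1 hua ε hε] with k hk s
      rw [dist_comm]
      exact (dist_scaledFun_le _ _ _ _).trans_lt hk
    refine ⟨h1.tendstoUniformlyOn.tendstoLocallyUniformlyOn.differentiableOn
      (Filter.Eventually.of_forall fun k => (hu k).differentiableOn) Metric.isOpen_ball,
      h1.tendstoUniformlyOn.continuousOn
        (Filter.Frequently.of_forall fun k => (hu k).continuousOn)⟩

/-- On the diagonal of the semicrossed product, the compression to the representations `(ρ, 0)` is
the identity. -/
lemma scaled_zero_of_star {a b : semicrossedProduct σ}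
    (h : (b : UniversalSpace (Set.univ : Set (CovariantRep σ)) →L[ℂ] _) = star a.1)
    (r : CovariantRep σ) : scaled r 0 (by simp) a = scaled r 1 norm_one.le a := by
  refine ContinuousLinearMap.ext fun x => ext_inner_left ℂ fun y => ?_
  have hd : ∀ (c : semicrossedProduct σ) (x y : r.H),
      DiffContOnCl ℂ (fun s => inner ℂ y (scaledFun r c s x)) (Metric.ball 0 1) := fun c x y =>
    let L : (r.H →L[ℂ] r.H) →L[ℂ] ℂ := innerSL ℂ y ∘L ContinuousLinearMap.apply ℂ r.H x
    L.differentiable.comp_diffContOnCl (diffContOnCl_scaledFun r c)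
  have hc : ∀ s ∈ Metric.ball (0 : ℂ) 1, inner ℂ x (scaledFun r b s y) =
      (starRingEnd ℂ) (inner ℂ y (scaledFun r a s x)) := by
    intro s hs
    have hs' : ‖s‖ ≤ 1 := (mem_ball_zero_iff.1 hs).le
    rw [scaledFun_of_le _ _ hs', scaledFun_of_le _ _ hs', inner_conj_symm]
    exact (component_star (R := Set.univ) ⟨r.scale s hs', trivial⟩ h x y).symm
  -- With `f(s)` the coefficient of `a`, the coefficient of `b` is its conjugate `f̄`; both `f + f̄`
  -- and `i(f - f̄)` are real and holomorphic, hence agree at `0` and `1`. So does `f`.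
  have h1 := eq_of_im_eq_zero ((hd a x y).add (hd b y x)) fun s hs => by
    rw [Pi.add_apply, hc s hs, Complex.add_im, Complex.conj_im, add_neg_cancel]
  have h2 := eq_of_im_eq_zero (((hd a x y).sub (hd b y x)).const_smul Complex.I) fun s hs => by
    rw [Pi.smul_apply, Pi.sub_apply, hc s hs, smul_eq_mul, Complex.I_mul_im, Complex.sub_re,
      Complex.conj_re, sub_self]
  simp only [Pi.add_apply, Pi.sub_apply, Pi.smul_apply, smul_eq_mul] at h1 h2
  have h3 := mul_left_cancel₀ Complex.I_ne_zero h2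
  rw [← scaledFun_of_le r a, ← scaledFun_of_le r a]
  linear_combination (-1 / 2 : ℂ) * h1 + (-1 / 2 : ℂ) * h3

lemma expectationHom_of_star {a b : semicrossedProduct σ}
    (h : (b : UniversalSpace (Set.univ : Set (CovariantRep σ)) →L[ℂ] _) = star a.1) :
    expectationHom a = a.1 := by
  ext x r
  change scaled r.1 0 _ a (x r) = _
  rw [scaled_zero_of_star h, scaled_one, component_apply]

/-- Evaluation at a point, as a representation by `1 × 1` matrices that annihilates the
generators. -/
def pointRep (σ : Fin n → C(X, X)) (x : X) :
    semicrossedProduct σ →ₐ[ℂ] Matrix (Fin 1) (Fin 1) ℂ :=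
  matrixComponent (R := (Set.univ : Set (CovariantRep σ))) (x := fun _ : Fin 1 => x)
    (S := fun _ => 0) (hS := by simp) (hc := fun _ _ _ h => absurd rfl h)
    (Set.mem_univ _)

/-- Evaluation at a point, as a character of the semicrossed product that annihilates the
generators. -/
def pointEval (σ : Fin n → C(X, X)) (x : X) : semicrossedProduct σ →ₐ[ℂ] ℂ where
  toFun a := pointRep σ x a 0 0
  map_one' := by rw [map_one, Matrix.one_apply_eq]
  map_mul' a b := by rw [map_mul, Matrix.mul_apply, Fin.sum_univ_one]
  map_zero' := by rw [map_zero, Matrix.zero_apply]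
  map_add' a b := by rw [map_add, Matrix.add_apply]
  commutes' c := by rw [AlgHomClass.commutes, Matrix.algebraMap_eq_diagonal,
    Matrix.diagonal_apply_eq, Pi.algebraMap_apply]

lemma pointEval_apply (x : X) (a : semicrossedProduct σ) :
    pointEval σ x a = pointRep σ x a 0 0 := rfl

lemma pointEval_func (x : X) (f : C(X, ℂ)) : pointEval σ x (func _ f) = f x := by
  rw [pointEval_apply, pointRep, matrixComponent_func, Matrix.diagonal_apply_eq]

lemma norm_pointEval_le (x : X) (a : semicrossedProduct σ) : ‖pointEval σ x a‖ ≤ ‖a‖ :=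
  (norm_entry_le (pointRep σ x a) 0 0).trans ((matrixComponent_isCCRep (Set.mem_univ _)).norm_le a)

/-- Point evaluations are representations of the algebra and give the lower bound. -/
lemma norm_universalFun (f : C(X, ℂ)) :
    ‖universalFun (Set.univ : Set (CovariantRep σ)) f‖ = ‖f‖ := by
  refine le_antisymm (directSum_norm_le _ _ _ _)
    ((ContinuousMap.norm_le f (norm_nonneg _)).2 fun x => ?_)
  rw [← pointEval_func (σ := σ)]
  exact norm_pointEval_le x _

lemma isClosed_range_universalFun :
    IsClosed (Set.range (universalFun (Set.univ : Set (CovariantRep σ)))) := by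
  have h : Isometry (universalFun (Set.univ : Set (CovariantRep σ))) := by
    refine Isometry.of_dist_eq fun f g => ?_
    rw [dist_eq_norm, dist_eq_norm, ← norm_universalFun (σ := σ) (f - g)]
    rw [universalFun_sub]
  exact h.isClosedEmbedding.isClosed_range

lemma expectationHom_func (f : C(X, ℂ)) :
    expectationHom (func (Set.univ : Set (CovariantRep σ)) f) = universalFun _ f := by
  ext x r
  change scaled r.1 0 _ _ (x r) = _
  rw [scaled_func]
  rfl

lemma expectationHom_gen (i : Fin n) :
    expectationHom (gen (Set.univ : Set (CovariantRep σ)) i) = 0 := by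
  ext x r
  change scaled r.1 0 _ _ (x r) = _
  rw [scaled_gen, zero_smul]
  rfl

lemma continuous_expectationHom : Continuous (expectationHom (σ := σ)) :=
  continuous_of_norm_le (expectationHom (σ := σ)).toLinearMap
    (expectationHom_completelyContractive (σ := σ)).norm_le

/-- The copy of `C(X)` is a closed subalgebra, being an isometric image of a complete space, and the
generators go to zero. -/
lemma expectationHom_mem_range (a : semicrossedProduct σ) :
    expectationHom a ∈ Set.range (universalFun (Set.univ : Set (CovariantRep σ))) := by
  refine universalAlgebra_induction (P := fun a => expectationHom a ∈
    Set.range (universalFun (Set.univ : Set (CovariantRep σ)))) ?_ ?_ ?_ ?_ ?_ a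
  · exact fun f => ⟨f, (expectationHom_func f).symm⟩
  · refine fun i => ⟨0, ?_⟩
    rw [expectationHom_gen, universalFun_zero]
  · rintro a b ⟨f, hf⟩ ⟨g, hg⟩
    refine ⟨f + g, ?_⟩
    rw [map_add, ← hf, ← hg, universalFun_add]
  · rintro a b ⟨f, hf⟩ ⟨g, hg⟩
    refine ⟨f * g, ?_⟩
    rw [map_mul, ← hf, ← hg, universalFun_mul]
  · exact isClosed_range_universalFun.preimage continuous_expectationHom

lemma expectationHom_mem_diagonal (a : semicrossedProduct σ) :
    expectationHom a ∈ diagonal (semicrossedProduct σ) := by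
  obtain ⟨f, hf⟩ := expectationHom_mem_range a
  rw [← hf]
  exact (universalHom Set.univ f).2

/-- An element of the diagonal is fixed by the expectation, whose values lie in `C(X)`. -/
lemma universalHom_surjective :
    Function.Surjective (universalHom (Set.univ : Set (CovariantRep σ))) := by
  rintro ⟨a, ha, ha'⟩
  obtain ⟨f, hf⟩ := expectationHom_mem_range (σ := σ) ⟨a, ha⟩
  refine ⟨f, Subtype.ext ?_⟩
  rw [expectationHom_of_star (a := ⟨a, ha⟩) (b := ⟨star a, ha'⟩) rfl] at hf
  exact hf

/-- The canonical expectation of the semicrossed product onto its diagonal. -/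
def canonicalExpectation (σ : Fin n → C(X, X)) : DiagonalExpectation (semicrossedProduct σ) where
  toLin :=
    { toFun := fun a => ⟨expectationHom a, expectationHom_mem_diagonal a⟩
      map_add' := fun a b => Subtype.ext (map_add expectationHom a b)
      map_smul' := fun c a => Subtype.ext (map_smul expectationHom c a) }
  completelyContractive := expectationHom_completelyContractive
  map_diagonal a ha :=
    Subtype.ext (expectationHom_of_star (a := a) (b := ⟨star a.1, ha.2⟩) rfl)

end Semicrossed

/-! ### Vertices as points of `X`, and the topological partition -/

section Vertices

variable {X : Type u} [TopologicalSpace X] [CompactSpace X] {n : ℕ} {σ : Fin n → C(X, X)}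

/-- The inclusion of the diagonal in the algebra. -/
def diagonalInclusion {H : Type u} [NormedAddCommGroup H] [InnerProductSpace ℂ H]
    [CompleteSpace H] (A : Subalgebra ℂ (H →L[ℂ] H)) : diagonal A →ₐ[ℂ] A where
  toFun a := ⟨a.1, a.2.1⟩
  map_one' := rfl
  map_mul' _ _ := rfl
  map_zero' := rfl
  map_add' _ _ := rfl
  commutes' _ := rfl

/-- Evaluation at a point of `X`, as a homomorphism on the diagonal of the semicrossed product. -/
def diagonalEval (σ : Fin n → C(X, X)) (x : X) : diagonal (semicrossedProduct σ) →ₐ[ℂ] ℂ :=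
  (pointEval σ x).comp (diagonalInclusion (semicrossedProduct σ))

lemma norm_diagonalEval_le (x : X) (a : diagonal (semicrossedProduct σ)) :
    ‖diagonalEval σ x a‖ ≤ ‖a‖ := norm_pointEval_le x _

/-- The vertex of the semicrossed product at a point of `X`. -/
def evalVertex (σ : Fin n → C(X, X)) (x : X) : Vertex (semicrossedProduct σ) :=
  ⟨LinearMap.mkContinuous (diagonalEval σ x).toLinearMap 1
    (fun a => by rw [one_mul]; exact norm_diagonalEval_le x a),
  fun h => one_ne_zero (α := ℂ) ((diagonalEval σ x).map_one'.symm.trans (DFunLike.congr_fun h 1)),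
  (diagonalEval σ x).map_mul'⟩

lemma evalVertex_universalHom (x : X) (f : C(X, ℂ)) :
    evalVertex σ x (universalHom Set.univ f) = f x := pointEval_func x f

lemma continuous_evalVertex : Continuous (evalVertex σ) := by
  refine Continuous.subtype_mk (WeakDual.continuous_of_continuous_eval fun a => ?_) _
  obtain ⟨f, rfl⟩ := universalHom_surjective a
  exact f.continuous.congr fun x => (evalVertex_universalHom x f).symm

variable [T2Space X]

lemma basePoint_evalVertex (x : X) : basePoint (evalVertex σ x) = x :=
  eq_of_continuousMap_eq fun f => by rw [← basePoint_spec, evalVertex_universalHom]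

lemma vertex_ext {v w : Vertex (semicrossedProduct σ)} (h : basePoint v = basePoint w) :
    v = w := by
  refine DFunLike.ext _ _ fun a => ?_
  obtain ⟨f, rfl⟩ := universalHom_surjective a
  rw [basePoint_spec, basePoint_spec, h]

lemma continuous_basePoint :
    Continuous (basePoint : Vertex (semicrossedProduct σ) → X) := by
  refine (WeakDual.CharacterSpace.homeoEval X ℂ).symm.continuous.comp ?_
  refine Continuous.subtype_mk (WeakDual.continuous_of_continuous_eval fun f => ?_) _
  exact (WeakDual.eval_continuous (universalHom Set.univ f)).comp continuous_subtype_val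

variable (σ) in
/-- The vertices of the semicrossed product are the points of `X`. -/
def vertexHomeomorph : Vertex (semicrossedProduct σ) ≃ₜ X where
  toFun := basePoint
  invFun := evalVertex σ
  left_inv _ := vertex_ext (basePoint_evalVertex _)
  right_inv := basePoint_evalVertex
  continuous_toFun := continuous_basePoint
  continuous_invFun := continuous_evalVertex

/-- Each `σ i` is defined on all of `X`, so every vertex is the source of an edge of every class. -/
lemma partitionSpace_semicrossedPart (p : Fin n × Vertex (semicrossedProduct σ)) :
    p ∈ partitionSpace (semicrossedPart σ) :=
  ⟨⟨evalVertex σ (σ p.1 (basePoint p.2)), p.2, ⟨p.1, (basePoint_evalVertex _).symm⟩⟩, rfl, rfl⟩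

lemma partitionRange_semicrossedPart (p : partitionSpace (semicrossedPart σ)) :
    partitionRange _ p = evalVertex σ (σ p.1.1 (basePoint p.1.2)) := by
  have key : ∀ e : Edge (semicrossedIndex σ),
      e.range = evalVertex σ (σ (semicrossedPart σ e) (basePoint e.source)) := fun e =>
    vertex_ext (by rw [basePoint_evalVertex]; exact e.idx.2.symm)
  have h := key p.2.choose
  rwa [p.2.choose_spec.1, p.2.choose_spec.2] at h

lemma continuous_partitionRange :
    Continuous (partitionRange (semicrossedPart σ)) := by
  have h : Continuous fun p : Fin n × Vertex (semicrossedProduct σ) =>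
      evalVertex σ (σ p.1 (basePoint p.2)) := by
    refine continuous_prod_of_discrete_left.2 fun i => ?_
    exact continuous_evalVertex.comp ((σ i).continuous.comp continuous_basePoint)
  exact (h.comp continuous_subtype_val).congr fun p => (partitionRange_semicrossedPart p).symm

/-- The space of the partition is `n` disjoint copies of the vertex space, and the source map is the
projection. Properness of the range map is automatic from a compact space to a Hausdorff one. -/
lemma isTopologicalPartition_semicrossedPart : IsTopologicalPartition (semicrossedPart σ) where
  source_ne := by
    rintro ⟨r, s, i, hi⟩ ⟨r', s', i', hi'⟩ h hne hs
    change i = i' at h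
    change s = s' at hs
    subst h hs
    obtain rfl : r = r' := vertex_ext (hi.symm.trans hi')
    exact hne rfl
  source_localHomeo := by
    have h1 : IsLocalHomeomorph (Prod.snd : Fin n × Vertex (semicrossedProduct σ) → _) := by
      refine isLocalHomeomorph_iff_isOpenEmbedding_restrict.2 fun p =>
        ⟨{p.1} ×ˢ Set.univ, (((isOpen_discrete _).prod isOpen_univ).mem_nhds (by simp)), ?_⟩
      refine Topology.IsOpenEmbedding.of_continuous_injective_isOpenMap
        (continuous_snd.comp continuous_subtype_val) ?_
        (isOpenMap_snd.domRestrict ((isOpen_discrete _).prod isOpen_univ))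
      rintro ⟨⟨i, v⟩, hi, _⟩ ⟨⟨j, w⟩, hj, _⟩ h
      change v = w at h
      obtain rfl : i = j := hi.trans hj.symm
      subst h
      rfl
    have h2 : partitionSpace (semicrossedPart σ) = Set.univ :=
      Set.eq_univ_of_forall partitionSpace_semicrossedPart
    have h3 : IsOpen (partitionSpace (semicrossedPart σ)) := h2 ▸ isOpen_univ
    exact h1.comp h3.isOpenEmbedding_subtypeVal.isLocalHomeomorph
  range_continuous := continuous_partitionRange
  range_proper := by
    have h1 : CompactSpace (Vertex (semicrossedProduct σ)) :=
      (vertexHomeomorph σ).symm.compactSpace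
    have h2 : partitionSpace (semicrossedPart σ) = Set.univ :=
      Set.eq_univ_of_forall partitionSpace_semicrossedPart
    have : CompactSpace (partitionSpace (semicrossedPart σ)) :=
      isCompact_iff_compactSpace.1 (by rw [h2]; exact isCompact_univ)
    have h3 : T2Space (Vertex (semicrossedProduct σ)) := (vertexHomeomorph σ).symm.t2Space
    exact continuous_partitionRange.isProperMap

end Vertices

/-! ### Contractive matrix representations restricted to `C(X)` -/

section Contractive

variable {X : Type u} [TopologicalSpace X] [CompactSpace X] {n : ℕ} {σ : Fin n → C(X, X)}
  {R : Set (CovariantRep σ)}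

/-- The canonical homomorphism from `C(X)` to the universal algebra. -/
def funcHom (R : Set (CovariantRep σ)) : C(X, ℂ) →ₐ[ℂ] universalAlgebra R :=
  (diagonalInclusion (universalAlgebra R)).comp (universalHom R).toAlgHom

lemma norm_func_le (f : C(X, ℂ)) : ‖func R f‖ ≤ ‖f‖ :=
  show ‖universalFun R f‖ ≤ ‖f‖ from directSum_norm_le _ _ _ _

/-- A contractive representation by matrices is diagonal on `C(X)` if its diagonal entries are
given there by evaluations. -/
lemma diagonal_of_contractive {p : ℕ} (Φ : universalAlgebra R →ₐ[ℂ] Matrix (Fin p) (Fin p) ℂ)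
    (hΦ : ∀ a, ‖Matrix.toEuclideanCLM (n := Fin p) (𝕜 := ℂ) (Φ a)‖ ≤ ‖a‖) (x : Fin p → X)
    (hx : ∀ f k, Φ (func R f) k k = f (x k)) (f : C(X, ℂ)) :
    Φ (func R f) = Matrix.diagonal fun k => f (x k) := by
  -- At a unitary `u` the diagonal entry already has modulus one while the row has norm at most one,
  -- so the rest of the row vanishes. Unitaries span `C(X)`.
  have h1 : ∀ k l, k ≠ l → ∀ u ∈ unitary C(X, ℂ), Φ (func R u) k l = 0 := by
    intro k l hkl u hu
    have hu1 : ∀ y, ‖u y‖ = 1 := fun y => by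
      have h := DFunLike.congr_fun (Unitary.star_mul_self_of_mem hu) y
      have h' : (starRingEnd ℂ) (u y) * u y = 1 := h
      rw [Complex.conj_mul'] at h'
      norm_cast at h'
      exact (pow_eq_one_iff_of_nonneg (norm_nonneg _) two_ne_zero).1 h'
    have h2 : ‖func R u‖ ≤ 1 := (norm_func_le u).trans
      ((ContinuousMap.norm_le u zero_le_one).2 fun y => (hu1 y).le)
    have h3 := (norm_row_le (Φ (func R u)) k).trans
      (pow_le_one₀ (norm_nonneg _) ((hΦ _).trans h2))
    have h4 : ‖Φ (func R u) k k‖ ^ 2 + ‖Φ (func R u) k l‖ ^ 2 ≤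
        ∑ j, ‖Φ (func R u) k j‖ ^ 2 :=
      Finset.add_le_sum (f := fun j => ‖Φ (func R u) k j‖ ^ 2) (fun _ _ => by positivity)
        (Finset.mem_univ k) (Finset.mem_univ l) hkl
    rw [hx, hu1] at h4
    have h5 : ‖Φ (func R u) k l‖ ^ 2 ≤ 0 := by linarith
    simpa using h5
  ext k l
  by_cases hkl : k = l
  · subst hkl
    rw [hx, Matrix.diagonal_apply_eq]
  · rw [Matrix.diagonal_apply_ne _ hkl]
    let L : C(X, ℂ) →ₗ[ℂ] ℂ :=
      Matrix.entryLinearMap ℂ ℂ k l ∘ₗ Φ.toLinearMap ∘ₗ (funcHom R).toLinearMap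
    have h2 : Submodule.span ℂ (unitary C(X, ℂ) : Set C(X, ℂ)) ≤ LinearMap.ker L :=
      Submodule.span_le.2 fun u hu => h1 k l hkl u hu
    rw [CStarAlgebra.span_unitary] at h2
    exact h2 (Submodule.mem_top (x := f))

end Contractive

/-! ### Connections between vertices and representations realizing them -/

section Connections

variable {X : Type u} [TopologicalSpace X] [CompactSpace X] {n : ℕ} {σ : Fin n → C(X, X)}
  {φ : DiagonalExpectation (semicrossedProduct σ)}

/-- An expectation of the semicrossed product that is a homomorphism and annihilates the
generators. -/
structure IsCanonical (φ : DiagonalExpectation (semicrossedProduct σ)) : Prop where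
  map_mul : ∀ a b, φ.toLin (a * b) = φ.toLin a * φ.toLin b
  map_gen : ∀ i, φ.toLin (gen Set.univ i) = 0

lemma isCanonical_canonicalExpectation : IsCanonical (canonicalExpectation σ) where
  map_mul a b := Subtype.ext (map_mul expectationHom a b)
  map_gen i := Subtype.ext (expectationHom_gen i)

lemma toLin_func (φ : DiagonalExpectation (semicrossedProduct σ)) (f : C(X, ℂ)) :
    φ.toLin (func Set.univ f) = universalHom Set.univ f :=
  φ.map_diagonal (func Set.univ f) (universalHom Set.univ f).2

lemma continuous_toLin (φ : DiagonalExpectation (semicrossedProduct σ)) : Continuous φ.toLin :=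
  continuous_of_norm_le φ.toLin φ.completelyContractive.norm_le

lemma continuous_vertex_toLin (φ : DiagonalExpectation (semicrossedProduct σ))
    (v : Vertex (semicrossedProduct σ)) : Continuous fun a => v (φ.toLin a) :=
  (map_continuous v).comp (continuous_toLin φ)

lemma vertex_toLin_mul (hφ : IsCanonical φ) (v : Vertex (semicrossedProduct σ))
    (a b : semicrossedProduct σ) :
    v (φ.toLin (a * b)) = v (φ.toLin a) * v (φ.toLin b) := by
  rw [hφ.map_mul]
  exact v.2.2 _ _

/-- The entries of a representation by matrices, as functionals. -/
def entry {p : ℕ} (Φ : semicrossedProduct σ →ₐ[ℂ] Matrix (Fin p) (Fin p) ℂ) (k l : Fin p) :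
    semicrossedProduct σ →ₗ[ℂ] ℂ :=
  Matrix.entryLinearMap ℂ ℂ k l ∘ₗ Φ.toLinearMap

section

variable {p : ℕ} {Φ : semicrossedProduct σ →ₐ[ℂ] Matrix (Fin p) (Fin p) ℂ}

lemma entry_apply (k l : Fin p) (a : semicrossedProduct σ) : entry Φ k l a = Φ a k l := rfl

lemma continuous_entry (hΦ : Continuous Φ) (k l : Fin p) : Continuous (entry Φ k l) :=
  hΦ.matrix_elem k l

lemma entry_mul (k l : Fin p) (a b : semicrossedProduct σ) :
    entry Φ k l (a * b) = ∑ j, entry Φ k j a * entry Φ j l b :=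
  (congrArg (fun M : Matrix (Fin p) (Fin p) ℂ => M k l) (map_mul Φ a b)).trans Matrix.mul_apply

end

/-- The functionals `t` for which `[[w ∘ φ, t], [0, v ∘ φ]]` is a continuous representation. -/
structure IsConnection (φ : DiagonalExpectation (semicrossedProduct σ))
    (w v : Vertex (semicrossedProduct σ)) (t : semicrossedProduct σ →ₗ[ℂ] ℂ) : Prop where
  continuous : Continuous t
  map_mul : ∀ a b, t (a * b) = w (φ.toLin a) * t b + t a * v (φ.toLin b)
  map_func : ∀ f, t (func Set.univ f) = 0

namespace IsConnection

variable {w v : Vertex (semicrossedProduct σ)} {t t' : semicrossedProduct σ →ₗ[ℂ] ℂ}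

/-- The product rule determines `t` on the algebra generated by `C(X)` and the `S_i`, and continuity
does the rest. -/
lemma ext (ht : IsConnection φ w v t) (ht' : IsConnection φ w v t')
    (h : ∀ i, t (gen Set.univ i) = t' (gen Set.univ i)) : t = t' := by
  refine LinearMap.ext fun a => ?_
  refine universalAlgebra_induction (P := fun a => t a = t' a) ?_ h ?_ ?_ ?_ a
  · intro f
    rw [ht.map_func, ht'.map_func]
  · intro a b ha hb
    rw [map_add, map_add, ha, hb]
  · intro a b ha hb
    rw [ht.map_mul, ht'.map_mul, ha, hb]
  · exact isClosed_eq ht.continuous ht'.continuous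

lemma add (ht : IsConnection φ w v t) (ht' : IsConnection φ w v t') :
    IsConnection φ w v (t + t') where
  continuous := ht.continuous.add ht'.continuous
  map_mul a b := by
    simp only [LinearMap.add_apply, ht.map_mul, ht'.map_mul]
    ring
  map_func f := by
    rw [LinearMap.add_apply, ht.map_func, ht'.map_func, add_zero]

lemma smul (ht : IsConnection φ w v t) (c : ℂ) : IsConnection φ w v (c • t) where
  continuous := ht.continuous.const_smul c
  map_mul a b := by
    simp only [LinearMap.smul_apply, ht.map_mul, smul_eq_mul]
    ring
  map_func f := by
    rw [LinearMap.smul_apply, ht.map_func, smul_zero]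

lemma zero : IsConnection φ w v 0 where
  continuous := continuous_const
  map_mul a b := by simp
  map_func f := rfl

lemma sum {J : Type v} (s : Finset J) {t : J → semicrossedProduct σ →ₗ[ℂ] ℂ}
    (ht : ∀ j, IsConnection φ w v (t j)) : IsConnection φ w v (∑ j ∈ s, t j) := by
  classical
  induction s using Finset.induction_on with
  | empty => exact zero
  | insert j s hj ih =>
    rw [Finset.sum_insert hj]
    exact (ht j).add ih

end IsConnection

variable [T2Space X]

lemma vertex_toLin_func (φ : DiagonalExpectation (semicrossedProduct σ))
    (v : Vertex (semicrossedProduct σ)) (f : C(X, ℂ)) :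
    v (φ.toLin (func Set.univ f)) = f (basePoint v) := by
  rw [toLin_func, basePoint_spec]

namespace IsConnection

variable {w v : Vertex (semicrossedProduct σ)} {t : semicrossedProduct σ →ₗ[ℂ] ℂ}

/-- Applying `t` to `f S_i = S_i (f ∘ σ_i)` gives `f(w) t(S_i) = t(S_i) f(σ_i(v))`. -/
lemma basePoint_eq (ht : IsConnection φ w v t) {i : Fin n} (h : t (gen Set.univ i) ≠ 0) :
    σ i (basePoint v) = basePoint w := by
  refine eq_of_continuousMap_eq fun f => ?_
  have h1 := congrArg t (func_mul_gen (R := Set.univ) f i)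
  have h2 := ht.map_mul (func Set.univ f) (gen Set.univ i)
  have h3 := ht.map_mul (gen Set.univ i) (func Set.univ (f.comp (σ i)))
  rw [ht.map_func f, vertex_toLin_func φ w f, zero_mul, add_zero] at h2
  rw [ht.map_func (f.comp (σ i)), vertex_toLin_func φ v (f.comp (σ i)), mul_zero, zero_add] at h3
  rw [h2, h3, mul_comm] at h1
  exact (mul_left_cancel₀ h h1).symm

lemma of_isCCRep {T : semicrossedProduct σ →ₐ[ℂ] Matrix (Fin 2) (Fin 2) ℂ}
    (hT : IsCCRep (semicrossedProduct σ) T)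
    (h : ∀ a, T a = !![w (φ.toLin a), t a; 0, v (φ.toLin a)]) : IsConnection φ w v t := by
  have h00 : ∀ a, entry T 0 0 a = w (φ.toLin a) := fun a => by rw [entry_apply, h]; simp
  have h01 : ∀ a, entry T 0 1 a = t a := fun a => by rw [entry_apply, h]; simp
  have h11 : ∀ a, entry T 1 1 a = v (φ.toLin a) := fun a => by rw [entry_apply, h]; simp
  refine ⟨(continuous_entry hT.continuous 0 1).congr h01, fun a b => ?_, fun f => ?_⟩
  · have h1 := entry_mul (Φ := T) 0 1 a b
    rwa [Fin.sum_univ_two, h00, h01, h01, h01, h11] at h1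
  · have h1 := diagonal_of_contractive T hT.norm_le ![basePoint w, basePoint v] (fun f k => by
      fin_cases k
      · exact (h00 _).trans (vertex_toLin_func φ w f)
      · exact (h11 _).trans (vertex_toLin_func φ v f)) f
    rw [← h01, entry_apply, h1]
    exact Matrix.diagonal_apply_ne _ zero_ne_one

end IsConnection

set_option maxHeartbeats 1000000 in
/-- The matrix entries of a representation in which the generators have only entries in the first
row, off the diagonal. -/
lemma corner_entries (hφ : IsCanonical φ) {p : ℕ} {V : Fin (p + 1) → Vertex (semicrossedProduct σ)}
    {Φ : semicrossedProduct σ →ₐ[ℂ] Matrix (Fin (p + 1)) (Fin (p + 1)) ℂ} (hΦ : Continuous Φ)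
    (hf : ∀ f, Φ (func Set.univ f) = Matrix.diagonal fun k => f (basePoint (V k)))
    (hg : ∀ i k l, (k = l ∨ k ≠ 0) → Φ (gen Set.univ i) k l = 0) (a : semicrossedProduct σ) :
    (∀ k, Φ a k k = V k (φ.toLin a)) ∧ ∀ k l, k ≠ l → k ≠ 0 → Φ a k l = 0 := by
  refine universalAlgebra_induction (P := fun a => (∀ k, Φ a k k = V k (φ.toLin a)) ∧
    ∀ k l, k ≠ l → k ≠ 0 → Φ a k l = 0) ?_ ?_ ?_ ?_ ?_ a
  · intro f
    refine ⟨fun k => ?_, fun k l hkl _ => ?_⟩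
    · rw [hf, Matrix.diagonal_apply_eq, vertex_toLin_func]
    · rw [hf, Matrix.diagonal_apply_ne _ hkl]
  · intro i
    refine ⟨fun k => ?_, fun k l _ hk => hg i k l (Or.inr hk)⟩
    rw [hg i k k (Or.inl rfl), hφ.map_gen, map_zero]
  · rintro a b ⟨ha, ha'⟩ ⟨hb, hb'⟩
    refine ⟨fun k => ?_, fun k l hkl hk => ?_⟩
    · rw [map_add, Matrix.add_apply, ha, hb, map_add, map_add]
    · rw [map_add, Matrix.add_apply, ha' k l hkl hk, hb' k l hkl hk, add_zero]
  · rintro a b ⟨ha, ha'⟩ ⟨hb, hb'⟩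
    refine ⟨fun k => ?_, fun k l hkl hk => ?_⟩
    · have h1 : entry Φ k k (a * b) = entry Φ k k a * entry Φ k k b := by
        refine (entry_mul k k a b).trans (Finset.sum_eq_single k (fun j _ hj => ?_)
          fun h => absurd (Finset.mem_univ _) h)
        by_cases hk : k = 0
        · rw [entry_apply j, hb' j k hj (hk ▸ hj), mul_zero]
        · rw [entry_apply, ha' k j hj.symm hk, zero_mul]
      rw [entry_apply, entry_apply, entry_apply, ha, hb] at h1
      exact h1.trans (vertex_toLin_mul hφ (V k) a b).symm
    · refine (entry_mul k l a b).trans (Finset.sum_eq_zero fun j _ => ?_)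
      by_cases hj : k = j
      · rw [← hj, entry_apply k l, hb' k l hkl hk, mul_zero]
      · rw [entry_apply, ha' k j hj hk, zero_mul]
  · have h1 : IsClosed (⋂ k, {a : semicrossedProduct σ | entry Φ k k a = V k (φ.toLin a)}) :=
      isClosed_iInter fun k => isClosed_eq (continuous_entry hΦ k k) (continuous_vertex_toLin φ (V k))
    have h2 : IsClosed (⋂ (k) (l) (_ : k ≠ l) (_ : k ≠ 0),
        {a : semicrossedProduct σ | entry Φ k l a = 0}) :=
      isClosed_iInter fun k => isClosed_iInter fun l => isClosed_iInter fun _ =>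
        isClosed_iInter fun _ => isClosed_eq (continuous_entry hΦ k l) continuous_const
    convert h1.inter h2 using 1
    ext a
    simp only [Set.mem_inter_iff, Set.mem_iInter]
    rfl

/-- The matrix with the given first row and otherwise zero. -/
def rowMatrix {p : ℕ} (c : Fin (p + 1) → ℂ) : Matrix (Fin (p + 1)) (Fin (p + 1)) ℂ :=
  Matrix.of fun k l => if k = 0 then c l else 0

lemma norm_rowMatrix_le {p : ℕ} {c : Fin (p + 1) → ℂ} (hc : ∑ l, ‖c l‖ ^ 2 ≤ 1) :
    ‖Matrix.toEuclideanCLM (n := Fin (p + 1)) (𝕜 := ℂ) (rowMatrix c)‖ ≤ 1 := by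
  refine ContinuousLinearMap.opNorm_le_bound _ zero_le_one fun x => ?_
  rw [one_mul, ← sq_le_sq₀ (norm_nonneg _) (norm_nonneg _), EuclideanSpace.norm_sq_eq,
    EuclideanSpace.norm_sq_eq, Finset.sum_eq_single 0]
  · rw [toEuclideanCLM_apply]
    simp only [rowMatrix, Matrix.of_apply, if_true]
    calc ‖∑ l, c l * x l‖ ^ 2 ≤ (∑ l, ‖c l‖ * ‖x l‖) ^ 2 := by
          gcongr
          refine (norm_sum_le _ _).trans_eq (Finset.sum_congr rfl fun l _ => norm_mul _ _)
      _ ≤ (∑ l, ‖c l‖ ^ 2) * ∑ l, ‖x l‖ ^ 2 := Finset.sum_mul_sq_le_sq_mul_sq _ _ _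
      _ ≤ ∑ l, ‖x l‖ ^ 2 := mul_le_of_le_one_left (by positivity) hc
  · intro k _ hk
    rw [toEuclideanCLM_apply]
    simp [rowMatrix, hk]
  · simp

/-- Representations of the semicrossed product in which the generators have only entries in the
first row, off the diagonal. -/
lemma exists_starRep (hφ : IsCanonical φ) {p : ℕ}
    (V : Fin (p + 1) → Vertex (semicrossedProduct σ)) (c : Fin n → Fin (p + 1) → ℂ)
    (h0 : ∀ i, c i 0 = 0) (h1 : ∀ i, ∑ l, ‖c i l‖ ^ 2 ≤ 1)
    (h2 : ∀ i l, c i l ≠ 0 → σ i (basePoint (V l)) = basePoint (V 0)) :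
    ∃ Φ : semicrossedProduct σ →ₐ[ℂ] Matrix (Fin (p + 1)) (Fin (p + 1)) ℂ,
      IsCCRep (semicrossedProduct σ) Φ ∧ (∀ i l, Φ (gen Set.univ i) 0 l = c i l) ∧
      (∀ a k, Φ a k k = V k (φ.toLin a)) ∧ (∀ a k l, k ≠ l → k ≠ 0 → Φ a k l = 0) ∧
      ∀ l, l ≠ 0 → IsConnection φ (V 0) (V l) (entry Φ 0 l) := by
  let S : Fin n → Matrix (Fin (p + 1)) (Fin (p + 1)) ℂ := fun i => rowMatrix (c i)
  have hc : ∀ i k l, S i k l ≠ 0 → basePoint (V k) = σ i (basePoint (V l)) := by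
    intro i k l h
    simp only [S, rowMatrix, Matrix.of_apply] at h
    split_ifs at h with hk
    · rw [hk, h2 i l h]
    · exact absurd rfl h
  let Φ : semicrossedProduct σ →ₐ[ℂ] Matrix (Fin (p + 1)) (Fin (p + 1)) ℂ :=
    matrixComponent (R := (Set.univ : Set (CovariantRep σ))) (x := fun k => basePoint (V k))
      (S := S) (hS := fun i => norm_rowMatrix_le (h1 i)) (hc := hc) (Set.mem_univ _)
  have hΦ : IsCCRep (semicrossedProduct σ) Φ := matrixComponent_isCCRep (Set.mem_univ _)
  have hf : ∀ f, Φ (func Set.univ f) = Matrix.diagonal fun k => f (basePoint (V k)) :=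
    matrixComponent_func (Set.mem_univ _)
  have hg : ∀ i, Φ (gen Set.univ i) = S i := matrixComponent_gen (Set.mem_univ _)
  have hcorner := corner_entries hφ hΦ.continuous hf fun i k l hkl => by
    rw [hg]
    simp only [S, rowMatrix, Matrix.of_apply]
    split_ifs with hk
    · obtain rfl | hkl := hkl
      · rw [hk, h0]
      · exact absurd hk hkl
    · rfl
  refine ⟨Φ, hΦ, fun i l => ?_, fun a => (hcorner a).1, fun a => (hcorner a).2, fun l hl =>
    ⟨continuous_entry hΦ.continuous 0 l, fun a b => ?_, fun f => ?_⟩⟩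
  · rw [hg]
    rfl
  · have h := (entry_mul (Φ := Φ) 0 l a b).trans
      (Finset.sum_eq_add 0 l hl.symm (fun k _ hk => by
        rw [entry_apply k l, (hcorner b).2 k l hk.2 hk.1, mul_zero])
        (fun h => absurd (Finset.mem_univ _) h) fun h => absurd (Finset.mem_univ _) h)
    rwa [entry_apply 0 0, (hcorner a).1, entry_apply l l, (hcorner b).1] at h
  · rw [entry_apply, hf, Matrix.diagonal_apply_ne _ hl.symm]

/-- The representation of an edge. -/
lemma exists_edgeRep (hφ : IsCanonical φ) {w v : Vertex (semicrossedProduct σ)}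
    (i : semicrossedIndex σ w v) :
    ∃ t : semicrossedProduct σ →ₗ[ℂ] ℂ, IsConnection φ w v t ∧
      (∀ j, t (gen Set.univ j) = if j = i.1 then 1 else 0) ∧
      ∃ Φ : semicrossedProduct σ →ₐ[ℂ] Matrix (Fin 2) (Fin 2) ℂ,
        IsCCRep (semicrossedProduct σ) Φ ∧
        ∀ a, Φ a = !![w (φ.toLin a), t a; 0, v (φ.toLin a)] := by
  obtain ⟨Φ, hΦ, hg, hd, hz, hc⟩ := exists_starRep hφ ![w, v]
    (fun j => ![0, if j = i.1 then 1 else 0]) (fun _ => rfl)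
    (fun j => by
      rw [Fin.sum_univ_two]
      by_cases h : j = i.1 <;> simp [h])
    (fun j l h => by
      fin_cases l
      · exact absurd rfl h
      · by_cases hj : j = i.1
        · rw [hj]
          exact i.2
        · simp [hj] at h)
  refine ⟨entry Φ 0 1, hc 1 one_ne_zero, fun j => hg j 1, Φ, hΦ, fun a => ?_⟩
  ext k l
  fin_cases k <;> fin_cases l
  · exact hd a 0
  · rfl
  · exact hz a 1 0 one_ne_zero one_ne_zero
  · exact hd a 1

end Connections

/-! ### The basis of the edge spaces and the canonical graph -/

section EdgeBasis

lemma mem_nestKernel {X : Type u} [TopologicalSpace X] [CompactSpace X] {n : ℕ}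
    {σ : Fin n → C(X, X)} {φ : DiagonalExpectation (semicrossedProduct σ)}
    {w v : Vertex (semicrossedProduct σ)} {a : semicrossedProduct σ} :
    a ∈ φ.nestKernel w v ↔ ∀ T ∈ φ.nestReps w v, T a = 0 := by
  simp only [DiagonalExpectation.nestKernel, Submodule.mem_iInf, LinearMap.mem_ker]
  rfl

variable {X : Type u} [TopologicalSpace X] [CompactSpace X] [T2Space X] {n : ℕ}
  {σ : Fin n → C(X, X)} {φ : DiagonalExpectation (semicrossedProduct σ)}
  {w v : Vertex (semicrossedProduct σ)}

instance instFiniteSemicrossedIndex : Finite (semicrossedIndex σ w v) :=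
  inferInstanceAs (Finite {i : Fin n // σ i (basePoint v) = basePoint w})

/-- The functional of an edge. -/
def edgeFunctional (hφ : IsCanonical φ) (i : semicrossedIndex σ w v) :
    semicrossedProduct σ →ₗ[ℂ] ℂ := (exists_edgeRep hφ i).choose

lemma edgeFunctional_isConnection (hφ : IsCanonical φ) (i : semicrossedIndex σ w v) :
    IsConnection φ w v (edgeFunctional hφ i) := (exists_edgeRep hφ i).choose_spec.1

lemma edgeFunctional_gen (hφ : IsCanonical φ) (i : semicrossedIndex σ w v) (j : Fin n) :
    edgeFunctional hφ i (gen Set.univ j) = if j = i.1 then 1 else 0 :=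
  (exists_edgeRep hφ i).choose_spec.2.1 j

lemma exists_rep_edgeFunctional (hφ : IsCanonical φ) (i : semicrossedIndex σ w v) :
    ∃ Φ : semicrossedProduct σ →ₐ[ℂ] Matrix (Fin 2) (Fin 2) ℂ,
      IsCCRep (semicrossedProduct σ) Φ ∧
      ∀ a, Φ a = !![w (φ.toLin a), edgeFunctional hφ i a; 0, v (φ.toLin a)] :=
  (exists_edgeRep hφ i).choose_spec.2.2

/-- A functional of a connection is a combination of the functionals of the edges. -/
lemma IsConnection.eq_sum [Fintype (semicrossedIndex σ w v)] (hφ : IsCanonical φ)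
    {t : semicrossedProduct σ →ₗ[ℂ] ℂ} (ht : IsConnection φ w v t) :
    t = ∑ i : semicrossedIndex σ w v, t (gen Set.univ i.1) • edgeFunctional hφ i := by
  refine ht.ext (IsConnection.sum _ fun i => (edgeFunctional_isConnection hφ i).smul _)
    fun j => ?_
  rw [LinearMap.sum_apply]
  simp only [LinearMap.smul_apply, edgeFunctional_gen, smul_eq_mul, mul_ite, mul_one, mul_zero]
  -- If `t` does not vanish on the generator `j`, then `j` is the index of an edge from `v` to `w`.
  by_cases hj : t (gen Set.univ j) = 0
  · rw [hj]
    refine (Finset.sum_eq_zero fun i _ => ?_).symm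
    split_ifs with h
    · rw [← h, hj]
    · rfl
  · rw [Finset.sum_eq_single ⟨j, ht.basePoint_eq hj⟩, if_pos rfl]
    · intro i _ hi
      rw [if_neg]
      rintro rfl
      exact hi rfl
    · exact fun h => absurd (Finset.mem_univ _) h

/-- Each edge functional is the corner of one of the representations defining the kernel, and every
such corner is a combination of edge functionals. -/
lemma mem_nestKernel_iff (hφ : IsCanonical φ) {a : semicrossedProduct σ}
    (ha : φ.toLin a = 0) :
    a ∈ φ.nestKernel w v ↔ ∀ i : semicrossedIndex σ w v, edgeFunctional hφ i a = 0 := by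
  rw [mem_nestKernel]
  constructor
  · intro h i
    obtain ⟨Φ, hΦ, hΦ'⟩ := exists_rep_edgeFunctional hφ i
    have h0 : edgeFunctional hφ i ≠ 0 := fun h0 => by
      have h1 := edgeFunctional_gen hφ i i.1
      rw [h0, if_pos rfl] at h1
      exact zero_ne_one h1
    have h1 := h Φ ⟨hΦ, _, h0, hΦ'⟩
    rw [hΦ'] at h1
    simpa using congrArg (fun M : Matrix (Fin 2) (Fin 2) ℂ => M 0 1) h1
  · rintro h T ⟨hT, t, -, hTt⟩
    have := Fintype.ofFinite (semicrossedIndex σ w v)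
    have h1 : t a = 0 := by
      rw [(IsConnection.of_isCCRep hT hTt).eq_sum hφ, LinearMap.sum_apply]
      refine Finset.sum_eq_zero fun i _ => ?_
      rw [LinearMap.smul_apply, h, smul_zero]
    have hw : ∀ u : Vertex (semicrossedProduct σ), u (φ.toLin a) = 0 := fun u => by
      rw [ha]
      exact map_zero u
    rw [hTt, h1, hw, hw]
    ext k l
    fin_cases k <;> fin_cases l <;> rfl

/-- The coordinates of the elements of `ker φ`. -/
def coordinates (hφ : IsCanonical φ) (w v : Vertex (semicrossedProduct σ)) :
    φ.kernel →ₗ[ℂ] (semicrossedIndex σ w v → ℂ) :=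
  LinearMap.pi fun i => edgeFunctional hφ i ∘ₗ φ.kernel.subtype

lemma coordinates_apply (hφ : IsCanonical φ) (a : φ.kernel) (i : semicrossedIndex σ w v) :
    coordinates hφ w v a i = edgeFunctional hφ i a.1 := rfl

lemma ker_coordinates (hφ : IsCanonical φ) :
    LinearMap.ker (coordinates hφ w v) = (φ.nestKernel w v).comap φ.kernel.subtype := by
  ext a
  rw [LinearMap.mem_ker, funext_iff, Submodule.mem_comap]
  exact (mem_nestKernel_iff hφ a.2).symm

/-- The generator, as an element of `ker φ`. -/
def kernelGen (hφ : IsCanonical φ) (i : Fin n) : φ.kernel := ⟨gen Set.univ i, hφ.map_gen i⟩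

lemma coordinates_kernelGen [DecidableEq (semicrossedIndex σ w v)] (hφ : IsCanonical φ)
    (i : semicrossedIndex σ w v) :
    coordinates hφ w v (kernelGen hφ i.1) = Pi.single i 1 := by
  funext j
  rw [coordinates_apply, Pi.single_apply]
  refine (edgeFunctional_gen hφ j i.1).trans ?_
  by_cases h : j = i
  · rw [h, if_pos rfl, if_pos rfl]
  · rw [if_neg h, if_neg fun h' => h (Subtype.ext h'.symm)]

lemma coordinates_surjective (hφ : IsCanonical φ) :
    Function.Surjective (coordinates hφ w v) := by
  classical
  have := Fintype.ofFinite (semicrossedIndex σ w v)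
  intro c
  refine ⟨∑ i : semicrossedIndex σ w v, c i • kernelGen hφ i.1, ?_⟩
  rw [map_sum]
  simp only [map_smul, coordinates_kernelGen]
  funext j
  simp [Finset.sum_apply, Pi.single_apply]

/-- The space of connections in coordinates. -/
def edgeSpaceEquiv (hφ : IsCanonical φ) (w v : Vertex (semicrossedProduct σ)) :
    φ.EdgeSpace w v ≃ₗ[ℂ] (semicrossedIndex σ w v → ℂ) :=
  (Submodule.quotEquivOfEq _ _ (ker_coordinates hφ).symm).trans
    ((coordinates hφ w v).quotKerEquivOfSurjective (coordinates_surjective hφ))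

/-- The classes of the generators form a basis of the space of connections. -/
def edgeBasis (hφ : IsCanonical φ) (w v : Vertex (semicrossedProduct σ)) :
    Module.Basis (semicrossedIndex σ w v) ℂ (φ.EdgeSpace w v) :=
  Module.Basis.ofEquivFun (edgeSpaceEquiv hφ w v)

/-- Passing to the quotient subtracts `φ(a)`, a function on `X`, on which edge functionals vanish.
-/
lemma edgeBasis_coord_quot (hφ : IsCanonical φ) (i : semicrossedIndex σ w v)
    (a : semicrossedProduct σ) :
    (edgeBasis hφ w v).coord i (φ.quot w v a) = edgeFunctional hφ i a := by
  have h1 : (edgeBasis hφ w v).coord i (φ.quot w v a) =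
      edgeFunctional hφ i (a - ⟨φ.toLin a, (φ.toLin a).2.1⟩) := rfl
  obtain ⟨f, hf⟩ := universalHom_surjective (φ.toLin a)
  have h2 : (⟨φ.toLin a, (φ.toLin a).2.1⟩ : semicrossedProduct σ) = func Set.univ f := by
    refine Subtype.ext ?_
    change (φ.toLin a).1 = _
    rw [← hf]
    rfl
  rw [h1, map_sub, h2, (edgeFunctional_isConnection hφ i).map_func, sub_zero]

lemma edgeBasis_apply (hφ : IsCanonical φ) (i : semicrossedIndex σ w v) :
    edgeBasis hφ w v i = φ.quot w v (gen Set.univ i.1) := by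
  classical
  refine (edgeBasis hφ w v).ext_elem fun j => ?_
  refine Eq.trans ?_ (edgeBasis_coord_quot hφ j (gen Set.univ i.1)).symm
  rw [Module.Basis.repr_self, Finsupp.single_apply, edgeFunctional_gen]
  by_cases h : i = j
  · subst h
    rw [if_pos rfl, if_pos rfl]
  · rw [if_neg h, if_neg fun h' => h (Subtype.ext h')]

lemma exists_rep_edgeBasis (hφ : IsCanonical φ) (i : semicrossedIndex σ w v) :
    ∃ T : semicrossedProduct σ →ₐ[ℂ] Matrix (Fin 2) (Fin 2) ℂ,
      IsCCRep (semicrossedProduct σ) T ∧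
      ∀ a, T a = !![w (φ.toLin a), (edgeBasis hφ w v).coord i (φ.quot w v a);
        0, v (φ.toLin a)] := by
  obtain ⟨Φ, hΦ, hΦ'⟩ := exists_rep_edgeFunctional hφ i
  refine ⟨Φ, hΦ, fun a => (hΦ' a).trans ?_⟩
  rw [edgeBasis_coord_quot hφ i a]

/-- The edges of the semicrossed product. -/
def edgeFamily (hφ : IsCanonical φ) : EdgeFamily φ (semicrossedIndex σ) where
  basis := edgeBasis hφ
  edgeFree _ _ i := exists_rep_edgeBasis hφ i

variable (σ) in
/-- The graph of the semicrossed product. -/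
def canonicalGraph : SemicrossedGraph σ where
  φ := canonicalExpectation σ
  map_mul := isCanonical_canonicalExpectation.map_mul
  map_gen := isCanonical_canonicalExpectation.map_gen
  edges := edgeFamily isCanonical_canonicalExpectation
  basis_eq _ _ := edgeBasis_apply isCanonical_canonicalExpectation
  topological := isTopologicalPartition_semicrossedPart

end EdgeBasis

/-! ### Edge functionals of an arbitrary graph of the semicrossed product -/

section Graphs

variable {X : Type u} [TopologicalSpace X] [CompactSpace X] [T2Space X] {n : ℕ}
  {σ : Fin n → C(X, X)} (G : SemicrossedGraph σ)

lemma SemicrossedGraph.isCanonical : IsCanonical G.φ := ⟨G.map_mul, G.map_gen⟩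

lemma SemicrossedGraph.functional_isConnection (e : Edge (semicrossedIndex σ)) :
    IsConnection G.φ e.range e.source (G.edges.functional e) := by
  obtain ⟨T, hT, h⟩ := G.edges.edgeFree e.range e.source e.idx
  exact IsConnection.of_isCCRep hT h

/-- If `σ j` maps the source to the range, the class of the `j`-th generator is a basis element; if
not, covariance makes the functional vanish on it. -/
lemma SemicrossedGraph.functional_gen (e : Edge (semicrossedIndex σ)) (j : Fin n) :
    G.edges.functional e (gen Set.univ j) = if j = semicrossedPart σ e then 1 else 0 := by
  classical
  by_cases hj : σ j (basePoint e.source) = basePoint e.range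
  · let i : semicrossedIndex σ e.range e.source := ⟨j, hj⟩
    have h1 : G.edges.functional e (gen Set.univ j) =
        (G.edges.basis e.range e.source).repr
          (G.φ.quot e.range e.source (gen Set.univ i.1)) e.idx := rfl
    rw [h1, ← G.basis_eq e.range e.source i, Module.Basis.repr_self, Finsupp.single_apply]
    exact if_congr Subtype.ext_iff rfl rfl
  · rw [if_neg]
    · by_contra h
      exact hj ((G.functional_isConnection e).basePoint_eq h)
    · rintro rfl
      exact hj e.idx.2

end Graphs

/-! ## Colorable graphs -/

section Colorable

/-- Semicrossed product and tensor algebra are the same construction for two classes of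
representations, so it is enough that the classes coincide. -/
lemma completelyIsometricallyIsomorphic_of_eq {X : Type u} [TopologicalSpace X] [CompactSpace X] {n : ℕ}
    {σ : Fin n → C(X, X)} {R R' : Set (CovariantRep σ)} (h : R = R') :
    CompletelyIsometricallyIsomorphic (universalAlgebra R) (universalAlgebra R') := by
  subst h
  exact ⟨AlgEquiv.refl, fun _ _ => rfl⟩

variable {X : Type u} [TopologicalSpace X] [CompactSpace X] [T2Space X] {n : ℕ}
  {σ : Fin n → C(X, X)}

/-- A common value of `σ i` and `σ j` is the range of two edges whose joint `3 × 3` representation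
exists, which forbids giving `i` and `j` the same color. -/
lemma SemicrossedGraph.Colorable.disjoint_range {G : SemicrossedGraph σ} (hG : G.Colorable 1)
    {i j : Fin n} (hij : i ≠ j) : Disjoint (Set.range (σ i)) (Set.range (σ j)) := by
  rw [Set.disjoint_iff_forall_ne]
  rintro _ ⟨x, rfl⟩ _ ⟨y, rfl⟩ hxy
  obtain ⟨c, hc, hcard⟩ := hG
  refine hc i j ?_ (Set.encard_le_one_iff.1 hcard _ _ ⟨i, rfl⟩ ⟨j, rfl⟩)
  set r : Vertex (semicrossedProduct σ) := evalVertex σ (σ i x) with hr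
  set v₁ : Vertex (semicrossedProduct σ) := evalVertex σ x with hv₁
  set v₂ : Vertex (semicrossedProduct σ) := evalVertex σ y with hv₂
  have h1 : σ i (basePoint v₁) = basePoint r := by
    rw [hr, hv₁, basePoint_evalVertex, basePoint_evalVertex]
  have h2 : σ j (basePoint v₂) = basePoint r := by
    rw [hr, hv₂, basePoint_evalVertex, basePoint_evalVertex, hxy]
  let e₁ : Edge (semicrossedIndex σ) := ⟨r, v₁, ⟨i, h1⟩⟩
  let e₂ : Edge (semicrossedIndex σ) := ⟨r, v₂, ⟨j, h2⟩⟩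
  -- Since `i ≠ j`, each generator has at most one nonzero entry, equal to one, and so is a
  -- contraction.
  obtain ⟨Φ, hΦ, hg, hd, hz, hconn⟩ := exists_starRep G.isCanonical ![r, v₁, v₂]
    (fun k => ![0, if k = i then 1 else 0, if k = j then 1 else 0]) (fun _ => rfl)
    (fun k => by
      rw [Fin.sum_univ_three]
      by_cases hi : k = i
      · simp [hi, hij]
      · by_cases hj : k = j <;> simp [hi, hj, hij.symm])
    (fun k l h => by
      fin_cases l
      · exact absurd rfl h
      · by_cases hk : k = i
        · rw [hk]
          exact h1
        · simp [hk] at h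
      · by_cases hk : k = j
        · rw [hk]
          exact h2
        · simp [hk] at h)
  have ht₁ : entry Φ 0 1 = G.edges.functional e₁ :=
    (hconn 1 (by decide)).ext (G.functional_isConnection e₁) fun k =>
      (hg k 1).trans (G.functional_gen e₁ k).symm
  have ht₂ : entry Φ 0 2 = G.edges.functional e₂ :=
    (hconn 2 (by decide)).ext (G.functional_isConnection e₂) fun k =>
      (hg k 2).trans (G.functional_gen e₂ k).symm
  refine ⟨e₁, e₂, rfl, rfl, rfl, Φ, hΦ, fun a => ?_⟩
  rw [← ht₁, ← ht₂]
  ext k l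
  fin_cases k <;> fin_cases l
  · exact hd a 0
  · rfl
  · rfl
  · exact hz a 1 0 (by decide) (by decide)
  · exact hd a 1
  · exact hz a 1 2 (by decide) (by decide)
  · exact hz a 2 0 (by decide) (by decide)
  · exact hz a 2 1 (by decide) (by decide)
  · exact hd a 2

/-- Take `g` equal to `0` on the range of `σ i` and `1` on that of `σ j`. Then `ρ(g) S_j = S_j` and
`ρ(g)* S_i = 0`. -/
lemma inner_generators_eq_zero (r : CovariantRep σ) {i j : Fin n}
    (h : Disjoint (Set.range (σ i)) (Set.range (σ j))) (x y : r.H) :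
    inner ℂ (r.S i x) (r.S j y) = 0 := by
  obtain ⟨f, hf0, hf1, -⟩ := exists_continuous_zero_one_of_isClosed
    (isCompact_range (σ i).continuous).isClosed (isCompact_range (σ j).continuous).isClosed h
  let g : C(X, ℂ) := ⟨fun y => f y, by fun_prop⟩
  have h1 : (star g).comp (σ i) = 0 := by
    ext z
    have : f (σ i z) = 0 := hf0 ⟨z, rfl⟩
    simp [g, this]
  have h2 : g.comp (σ j) = 1 := by
    ext z
    have : f (σ j z) = 1 := hf1 ⟨z, rfl⟩
    simp [g, this]
  have h3 := DFunLike.congr_fun (r.covariant i (star g)) x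
  have h4 := DFunLike.congr_fun (r.covariant j g) y
  rw [h1, map_zero, mul_zero, map_star] at h3
  rw [h2, map_one, mul_one] at h4
  rw [← h4, mul_apply_eq_comp, ← ContinuousLinearMap.adjoint_inner_left,
    ← ContinuousLinearMap.star_eq_adjoint]
  change inner ℂ ((star (r.ρ g) * r.S i) x) _ = 0
  rw [h3]
  exact inner_zero_left _

/-- Pythagoras for contractions with orthogonal ranges. -/
lemma isRowContractive_of_disjoint
    (h : ∀ i j, i ≠ j → Disjoint (Set.range (σ i)) (Set.range (σ j))) (r : CovariantRep σ) :
    r.IsRowContractive := by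
  intro x
  have h1 : ‖∑ i, r.S i (x i)‖ ^ 2 = ∑ i, ‖r.S i (x i)‖ ^ 2 := by
    have h2 : inner ℂ (∑ i, r.S i (x i)) (∑ i, r.S i (x i)) =
        ∑ i, inner ℂ (r.S i (x i)) (r.S i (x i)) := by
      rw [sum_inner]
      refine Finset.sum_congr rfl fun i _ => ?_
      rw [inner_sum]
      refine Finset.sum_eq_single i (fun j _ hj => ?_) fun h => absurd (Finset.mem_univ _) h
      exact inner_generators_eq_zero r (h i j hj.symm) _ _
    simp only [inner_self_eq_norm_sq_to_K] at h2
    exact_mod_cast h2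
  rw [h1]
  gcongr with i
  exact ((r.S i).le_of_opNorm_le (r.contractive i) _).trans_eq (one_mul _)

lemma SemicrossedGraph.Colorable.isomorphic {G : SemicrossedGraph σ} (hG : G.Colorable 1) :
    CompletelyIsometricallyIsomorphic (semicrossedProduct σ) (tensorAlgebra σ) :=
  completelyIsometricallyIsomorphic_of_eq (Set.eq_univ_of_forall
    (isRowContractive_of_disjoint fun _ _ hij => hG.disjoint_range hij)).symm

end Colorable

/-! ## Isomorphisms with tensor algebras -/

section Isometries

variable {H : Type u} [NormedAddCommGroup H] [InnerProductSpace ℂ H]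
  {K : Type v} [NormedAddCommGroup K] [InnerProductSpace ℂ K]
  {A : Subalgebra ℂ (H →L[ℂ] H)} {B : Subalgebra ℂ (K →L[ℂ] K)} {e : A ≃ₐ[ℂ] B}

lemma norm_algEquiv (he : ∀ (k : ℕ) (M : Matrix (Fin k) (Fin k) A),
    ‖matOp (M.map fun a => (e a : K →L[ℂ] K))‖ = ‖matOp (M.map fun a => (a : H →L[ℂ] H))‖)
    (a : A) : ‖e a‖ ≤ ‖a‖ :=
  IsCompletelyContractive.norm_le (A := A) (f := B.val.toLinearMap ∘ₗ e.toLinearMap)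
    (fun k M => (he k M).le) a

lemma IsCCRep.comp_symm (he : ∀ (k : ℕ) (M : Matrix (Fin k) (Fin k) A),
    ‖matOp (M.map fun a => (e a : K →L[ℂ] K))‖ = ‖matOp (M.map fun a => (a : H →L[ℂ] H))‖)
    {p : ℕ} {T : A →ₐ[ℂ] Matrix (Fin p) (Fin p) ℂ} (hT : IsCCRep A T) :
    IsCCRep B (T.comp e.symm.toAlgHom) := by
  intro k M
  have h1 := he k (M.map e.symm)
  simp only [Matrix.map_map, Function.comp_def, AlgEquiv.apply_symm_apply] at h1
  rw [h1]
  exact hT k (M.map e.symm)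

lemma continuous_algEquiv_symm (he : ∀ (k : ℕ) (M : Matrix (Fin k) (Fin k) A),
    ‖matOp (M.map fun a => (e a : K →L[ℂ] K))‖ = ‖matOp (M.map fun a => (a : H →L[ℂ] H))‖) :
    Continuous e.symm := by
  refine continuous_of_norm_le e.symm.toLinearMap (norm_algEquiv (e := e.symm) fun k M => ?_)
  have h1 := he k (M.map e.symm)
  simp only [Matrix.map_map, Function.comp_def, AlgEquiv.apply_symm_apply] at h1
  exact h1.symm

end Isometries

/-- Half of the off-diagonal part of a `3 × 3` row contraction may be doubled. -/
lemma row_dichotomy {m : ℕ} (z a b p q : Fin m → ℂ)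
    (h : ∀ x y₁ y₂ : ℂ, ∑ j, (‖z j * x‖ ^ 2 + ‖a j * x + p j * y₁‖ ^ 2 +
      ‖b j * x + q j * y₂‖ ^ 2) ≤ ‖x‖ ^ 2 + ‖y₁‖ ^ 2 + ‖y₂‖ ^ 2) :
    (∀ x y : ℂ, ∑ j, (‖z j * x‖ ^ 2 + ‖√2 * a j * x + p j * y‖ ^ 2) ≤ ‖x‖ ^ 2 + ‖y‖ ^ 2) ∨
    (∀ x y : ℂ, ∑ j, (‖z j * x‖ ^ 2 + ‖√2 * b j * x + q j * y‖ ^ 2) ≤ ‖x‖ ^ 2 + ‖y‖ ^ 2) := by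
  simp only [Finset.sum_add_distrib] at h ⊢
  have hs : ((√2 : ℝ) : ℂ) ≠ 0 := by simp
  have hs2 : ‖((√2 : ℝ) : ℂ)‖ ^ 2 = 2 := by
    rw [Complex.norm_real, Real.norm_of_nonneg (Real.sqrt_nonneg _), Real.sq_sqrt zero_le_two]
  generalize ((√2 : ℝ) : ℂ) = s at hs hs2 ⊢
  -- Homogeneity reduces the scaled inequality to `x ≠ 0` normalized, via `y ↦ y / (s x)` with `|s|²
  -- = 2`; the case `x = 0` needs `hp`. What remains is that the excess of one corner is at most
  -- half of `1 - ∑ ‖z j‖²`.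
  have key : ∀ (a p : Fin m → ℂ), (∀ y : ℂ, ∑ j, ‖p j * y‖ ^ 2 ≤ ‖y‖ ^ 2) →
      (∀ y : ℂ, 2 * (∑ j, ‖a j + p j * y‖ ^ 2 - ‖y‖ ^ 2) ≤ 1 - ∑ j, ‖z j‖ ^ 2) →
      ∀ x y : ℂ, ∑ j, ‖z j * x‖ ^ 2 + ∑ j, ‖s * a j * x + p j * y‖ ^ 2 ≤ ‖x‖ ^ 2 + ‖y‖ ^ 2 := by
    intro a p hp ha x y
    by_cases hx : x = 0
    · simpa [hx] using hp y
    · have h1 := ha (y / (s * x))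
      have h2 : ∀ j, ‖s * a j * x + p j * y‖ ^ 2 =
          2 * ‖x‖ ^ 2 * ‖a j + p j * (y / (s * x))‖ ^ 2 := fun j => by
        rw [← hs2, ← mul_pow, ← mul_pow, ← norm_mul, ← norm_mul]
        congr 2
        field_simp
      have h3 : ‖y‖ ^ 2 = 2 * ‖x‖ ^ 2 * ‖y / (s * x)‖ ^ 2 := by
        rw [← hs2, ← mul_pow, ← mul_pow, ← norm_mul, ← norm_mul]
        congr 2
        field_simp
      have h4 : ∀ j, ‖z j * x‖ ^ 2 = ‖x‖ ^ 2 * ‖z j‖ ^ 2 := fun j => by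
        rw [norm_mul, mul_pow, mul_comm]
      simp only [h2, h4, ← Finset.mul_sum]
      rw [h3]
      have h5 := mul_le_mul_of_nonneg_left h1 (sq_nonneg ‖x‖)
      linarith
  have hp : ∀ y : ℂ, ∑ j, ‖p j * y‖ ^ 2 ≤ ‖y‖ ^ 2 := fun y => by simpa using h 0 y 0
  have hq : ∀ y : ℂ, ∑ j, ‖q j * y‖ ^ 2 ≤ ‖y‖ ^ 2 := fun y => by simpa using h 0 0 y
  by_contra hcon
  rw [not_or] at hcon
  have h1 := mt (key a p hp) hcon.1
  have h2 := mt (key b q hq) hcon.2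
  push Not at h1 h2
  obtain ⟨y₁, h1⟩ := h1
  obtain ⟨y₂, h2⟩ := h2
  -- The variables `y₁`, `y₂` are independent, so at `x = 1` the two excesses add up to at most `1 -
  -- ∑ ‖z j‖²`; they cannot both exceed half of it.
  have h3 := h 1 y₁ y₂
  simp only [mul_one, norm_one, one_pow] at h3
  linarith

/-! ### Row contractions and representations of tensor algebras -/

section RowContractions

lemma star_toEuclideanCLM_apply {p : ℕ} (M : Matrix (Fin p) (Fin p) ℂ)
    (y : EuclideanSpace ℂ (Fin p)) (l : Fin p) :
    star (Matrix.toEuclideanCLM (n := Fin p) (𝕜 := ℂ) M) y l = ∑ k, star (M k l) * y k := by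
  rw [← map_star, toEuclideanCLM_apply]
  rfl

variable {Y : Type u} [TopologicalSpace Y] [CompactSpace Y] {m : ℕ} {τ : Fin m → C(Y, Y)}

/-- The inequality holds in every summand and is summed. -/
lemma gen_row_contractive (x : Fin m → UniversalSpace {r : CovariantRep τ | r.IsRowContractive}) :
    ‖∑ j, (gen {r : CovariantRep τ | r.IsRowContractive} j).1 (x j)‖ ^ 2
      ≤ ∑ j, ‖x j‖ ^ 2 := by
  refine hasSum_le (fun r => ?_) (lp_hasSum_norm_sq _)
    (hasSum_sum fun j _ => lp_hasSum_norm_sq (x j))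
  rw [lp.coeFn_sum, Finset.sum_apply]
  exact r.2 fun j => x j r

lemma matrixRep_isRowContractive {p : ℕ} {x : Fin p → Y} {S : Fin m → Matrix (Fin p) (Fin p) ℂ}
    {hS : ∀ i, ‖Matrix.toEuclideanCLM (n := Fin p) (𝕜 := ℂ) (S i)‖ ≤ 1}
    {hc : ∀ i k l, S i k l ≠ 0 → x k = τ i (x l)}
    (h : ∀ y : Fin m → EuclideanSpace ℂ (Fin p),
      ‖∑ i, Matrix.toEuclideanCLM (n := Fin p) (𝕜 := ℂ) (S i) (y i)‖ ^ 2 ≤ ∑ i, ‖y i‖ ^ 2) :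
    (matrixRep x S hS hc).IsRowContractive := by
  have key : ∀ y : Fin m → LiftedSpace.{u} p,
      ‖∑ i, matrixHom.{u} p (S i) (y i)‖ ^ 2 ≤ ∑ i, ‖y i‖ ^ 2 := by
    intro y
    have h1 := h fun i => (liftSpace.{u} p).symm (y i)
    rw [← (liftSpace.{u} p).norm_map, map_sum] at h1
    simp only [LinearIsometryEquiv.norm_map] at h1
    exact h1
  exact key

lemma norm_le_one_of_row {K : Type v} [NormedAddCommGroup K] [InnerProductSpace ℂ K]
    {S : Fin m → (K →L[ℂ] K)}
    (h : ∀ y : Fin m → K, ‖∑ i, S i (y i)‖ ^ 2 ≤ ∑ i, ‖y i‖ ^ 2) (i : Fin m) : ‖S i‖ ≤ 1 := by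
  refine ContinuousLinearMap.opNorm_le_bound _ zero_le_one fun x => ?_
  have h1 := h (Pi.single i x)
  rw [Finset.sum_eq_single i, Finset.sum_eq_single i, Pi.single_eq_same,
    sq_le_sq₀ (norm_nonneg _) (norm_nonneg _)] at h1
  · rwa [one_mul]
  · intro j _ hj
    simp [Pi.single_eq_of_ne hj]
  · simp
  · intro j _ hj
    simp [Pi.single_eq_of_ne hj]
  · simp

lemma norm_gen_le (R : Set (CovariantRep τ)) (i : Fin m) : ‖gen R i‖ ≤ 1 :=
  show ‖universalGen R i‖ ≤ 1 from directSum_norm_le _ _ _ _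

/-- A representation by matrices of a tensor algebra that is diagonal on `C(Y)` and maps the
generators to a row contraction is completely contractive. -/
lemma isCCRep_of_row [T2Space Y] {p : ℕ} {x : Fin p → Y}
    {Ψ : tensorAlgebra τ →ₐ[ℂ] Matrix (Fin p) (Fin p) ℂ} (hΨ : Continuous Ψ)
    (hf : ∀ f, Ψ (func _ f) = Matrix.diagonal fun k => f (x k))
    (hrow : ∀ y : EuclideanSpace ℂ (Fin p),
      ∑ j, ‖star (Matrix.toEuclideanCLM (n := Fin p) (𝕜 := ℂ) (Ψ (gen _ j))) y‖ ^ 2 ≤ ‖y‖ ^ 2) :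
    IsCCRep (tensorAlgebra τ) Ψ := by
  have h1 := (row_contractive_iff _).2 hrow
  have hR : matrixRep x (fun j => Ψ (gen _ j)) (norm_le_one_of_row h1)
      (point_eq_of_covariant hf) ∈ {r : CovariantRep τ | r.IsRowContractive} :=
    matrixRep_isRowContractive h1
  rw [eq_matrixComponent hR hΨ hf fun _ => rfl]
  exact matrixComponent_isCCRep hR

end RowContractions

/-- The homomorphism `[[χ, t], [0, ψ]]`. -/
def upperHom {A : Type v} [Ring A] [Algebra ℂ A] (χ ψ : A →ₐ[ℂ] ℂ) (t : A →ₗ[ℂ] ℂ)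
    (ht : ∀ a b, t (a * b) = χ a * t b + t a * ψ b) : A →ₐ[ℂ] Matrix (Fin 2) (Fin 2) ℂ :=
  AlgHom.ofLinearMap
    { toFun := fun a => !![χ a, t a; 0, ψ a]
      map_add' := fun a b => by simp
      map_smul' := fun c a => by simp }
    (by
      -- Unitality: the product rule at `1 · 1` gives `t(1) = 2 t(1)`.
      have h1 := ht 1 1
      rw [mul_one, map_one χ, map_one ψ, one_mul, mul_one, left_eq_add] at h1
      simp [h1, Matrix.one_fin_two])
    (fun a b => by simp [ht])

lemma norm_sq_star_two (s : ℝ) (z a p : ℂ) (y : EuclideanSpace ℂ (Fin 2)) :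
    ‖star (Matrix.toEuclideanCLM (n := Fin 2) (𝕜 := ℂ) !![z, s * a; 0, p]) y‖ ^ 2 =
      ‖star z * y 0‖ ^ 2 + ‖s * star a * y 0 + star p * y 1‖ ^ 2 := by
  rw [EuclideanSpace.norm_sq_eq, Fin.sum_univ_two, star_toEuclideanCLM_apply,
    star_toEuclideanCLM_apply, Fin.sum_univ_two, Fin.sum_univ_two]
  simp

/-- Row contractivity is used in adjoint form because here the two corners separate: `y 1` and `y 2`
occur in different squares. -/
lemma norm_sq_star_three (z a b p q : ℂ) (y : EuclideanSpace ℂ (Fin 3)) :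
    ‖star (Matrix.toEuclideanCLM (n := Fin 3) (𝕜 := ℂ) !![z, a, b; 0, p, 0; 0, 0, q]) y‖ ^ 2 =
      ‖star z * y 0‖ ^ 2 + ‖star a * y 0 + star p * y 1‖ ^ 2 +
        ‖star b * y 0 + star q * y 2‖ ^ 2 := by
  rw [EuclideanSpace.norm_sq_eq, Fin.sum_univ_three, star_toEuclideanCLM_apply,
    star_toEuclideanCLM_apply, star_toEuclideanCLM_apply, Fin.sum_univ_three, Fin.sum_univ_three,
    Fin.sum_univ_three]
  simp

/-! ### Transport along an isomorphism with a tensor algebra -/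

section Isomorphisms

variable {X : Type u} [TopologicalSpace X] [CompactSpace X] [T2Space X] {n : ℕ}
  {σ : Fin n → C(X, X)} {φ : DiagonalExpectation (semicrossedProduct σ)}

lemma vertex_toLin_one (φ : DiagonalExpectation (semicrossedProduct σ))
    (v : Vertex (semicrossedProduct σ)) : v (φ.toLin 1) = 1 := by
  rw [← func_one, vertex_toLin_func]
  rfl

/-- The homomorphism `v ∘ φ`. -/
def vertexHom (hφ : IsCanonical φ) (v : Vertex (semicrossedProduct σ)) :
    semicrossedProduct σ →ₐ[ℂ] ℂ :=
  AlgHom.ofLinearMap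
    { toFun := fun a => v (φ.toLin a)
      map_add' := fun a b => by rw [map_add φ.toLin]; exact map_add v _ _
      map_smul' := fun c a => by rw [map_smul φ.toLin]; exact map_smul v _ _ }
    (vertex_toLin_one φ v) (vertex_toLin_mul hφ v)

/-- Applied to vertices transported along the isomorphism, so nothing need be known about how it
relates `C(X)` and `C(Y)`. -/
lemma exists_point {Y : Type v} [TopologicalSpace Y] [CompactSpace Y] [T2Space Y]
    (χ : C(Y, ℂ) →ₐ[ℂ] ℂ) : ∃ y, ∀ f, χ f = f y := by
  refine ⟨(WeakDual.CharacterSpace.homeoEval Y ℂ).symm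
    (WeakDual.CharacterSpace.equivAlgHom.symm χ), fun f => ?_⟩
  have h := (WeakDual.CharacterSpace.homeoEval Y ℂ).apply_symm_apply
    (WeakDual.CharacterSpace.equivAlgHom.symm χ)
  exact (DFunLike.congr_fun h f).symm

/-- The homomorphism determined by a connection. -/
def connectionHom (hφ : IsCanonical φ) {w v : Vertex (semicrossedProduct σ)}
    {t : semicrossedProduct σ →ₗ[ℂ] ℂ} (ht : IsConnection φ w v t) :
    semicrossedProduct σ →ₐ[ℂ] Matrix (Fin 2) (Fin 2) ℂ :=
  upperHom (vertexHom hφ w) (vertexHom hφ v) t ht.map_mul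

lemma continuous_connectionHom (hφ : IsCanonical φ) {w v : Vertex (semicrossedProduct σ)}
    {t : semicrossedProduct σ →ₗ[ℂ] ℂ} (ht : IsConnection φ w v t) :
    Continuous (connectionHom hφ ht) := by
  refine continuous_matrix fun k l => ?_
  fin_cases k <;> fin_cases l
  · exact continuous_vertex_toLin φ w
  · exact ht.continuous
  · exact continuous_const
  · exact continuous_vertex_toLin φ v

variable {Y : Type u} [TopologicalSpace Y] [CompactSpace Y] [T2Space Y] {m : ℕ}
  {τ : Fin m → C(Y, Y)} {e : semicrossedProduct σ ≃ₐ[ℂ] tensorAlgebra τ}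

/-- The functional of an edge cannot be rescaled. -/
lemma not_row_of_edge
    (he : ∀ (k : ℕ) (M : Matrix (Fin k) (Fin k) (semicrossedProduct σ)),
      ‖matOp (M.map fun a => (e a).1)‖ = ‖matOp (M.map fun a => a.1)‖)
    (hφ : IsCanonical φ) {w v : Vertex (semicrossedProduct σ)}
    {t : semicrossedProduct σ →ₗ[ℂ] ℂ} {T : semicrossedProduct σ →ₐ[ℂ] Matrix (Fin 2) (Fin 2) ℂ}
    (hT : IsCCRep (semicrossedProduct σ) T)
    (hTt : ∀ a, T a = !![w (φ.toLin a), t a; 0, v (φ.toLin a)]) {i : Fin n}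
    (hi : t (gen Set.univ i) = 1) :
    ¬ ∀ x y : ℂ, ∑ j, (‖star (vertexHom hφ w (e.symm (gen _ j))) * x‖ ^ 2 +
      ‖√2 * star (t (e.symm (gen _ j))) * x + star (vertexHom hφ v (e.symm (gen _ j))) * y‖ ^ 2)
        ≤ ‖x‖ ^ 2 + ‖y‖ ^ 2 := by
  intro hrow
  obtain ⟨y₀, hy₀⟩ := exists_point (((vertexHom hφ w).comp e.symm.toAlgHom).comp (funcHom _))
  obtain ⟨y₁, hy₁⟩ := exists_point (((vertexHom hφ v).comp e.symm.toAlgHom).comp (funcHom _))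
  have ht := IsConnection.of_isCCRep hT hTt
  -- The transported representation is still contractive, hence diagonal on `C(Y)`, so its corner
  -- vanishes there.
  have htf : ∀ f, t (e.symm (func _ f)) = 0 := by
    intro f
    have h1 := diagonal_of_contractive (T.comp e.symm.toAlgHom) (hT.comp_symm he).norm_le
      ![y₀, y₁] (fun f k => by
        fin_cases k
        · exact (congrArg (fun M : Matrix (Fin 2) (Fin 2) ℂ => M 0 0) (hTt _)).trans (hy₀ f)
        · exact (congrArg (fun M : Matrix (Fin 2) (Fin 2) ℂ => M 1 1) (hTt _)).trans (hy₁ f)) f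
    have h2 := congrArg (fun M : Matrix (Fin 2) (Fin 2) ℂ => M 0 1) ((hTt _).symm.trans h1)
    exact h2.trans (Matrix.diagonal_apply_ne _ zero_ne_one)
  have hs : IsConnection φ w v (((√2 : ℝ) : ℂ) • t) := ht.smul _
  let Ψ := (connectionHom hφ hs).comp e.symm.toAlgHom
  have hΨ : Continuous Ψ :=
    (continuous_connectionHom hφ hs).comp (continuous_algEquiv_symm he)
  have hΨa : ∀ b, Ψ b = !![vertexHom hφ w (e.symm b), (√2 : ℝ) * t (e.symm b); 0,
      vertexHom hφ v (e.symm b)] := fun b => rfl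
  -- The assumed inequality is row contractivity of the images of the generators after multiplying
  -- the corner by `√2`.
  have hcc : IsCCRep (tensorAlgebra τ) Ψ := by
    refine isCCRep_of_row (x := ![y₀, y₁]) hΨ (fun f => ?_) fun y => ?_
    · rw [hΨa, htf, mul_zero]
      ext k l
      fin_cases k <;> fin_cases l
      · exact hy₀ f
      · rfl
      · rfl
      · exact hy₁ f
    · refine le_trans (le_of_eq (Finset.sum_congr rfl fun j _ => ?_))
        ((hrow (y 0) (y 1)).trans_eq ?_)
      · rw [hΨa, norm_sq_star_two]
      · rw [EuclideanSpace.norm_sq_eq, Fin.sum_univ_two]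
  -- The contraction `S_i` is sent to a matrix with corner entry `√2 · t(S_i) = √2`.
  have h1 := ((norm_entry_le _ 0 1).trans (hcc.norm_le (e (gen Set.univ i)))).trans
    ((norm_algEquiv he _).trans (norm_gen_le _ i))
  rw [hΨa, AlgEquiv.symm_apply_apply, hi, mul_one] at h1
  have h2 : ‖((√2 : ℝ) : ℂ)‖ ≤ 1 := h1
  rw [Complex.norm_real, Real.norm_of_nonneg (Real.sqrt_nonneg _), Real.sqrt_le_one] at h2
  norm_num at h2

lemma SemicrossedGraph.colorable_of_isomorphic (G : SemicrossedGraph σ)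
    (h : CompletelyIsometricallyIsomorphic (semicrossedProduct σ) (tensorAlgebra τ)) :
    G.Colorable 1 := by
  obtain ⟨e, he⟩ := h
  refine ⟨fun _ => 0, ?_, ?_⟩
  swap
  · exact (Set.encard_le_encard Set.range_const_subset).trans_eq (Set.encard_singleton 0)
  -- For the constant coloring no two edges may satisfy the condition, not even within one class, so
  -- the representation `T` itself must be contradicted.
  rintro _ _ ⟨e₁, e₂, rfl, rfl, hr, T, hT, hTa⟩
  exfalso
  have hφ := G.isCanonical
  have hrow : ∀ y : EuclideanSpace ℂ (Fin 3), ∑ j, ‖star (Matrix.toEuclideanCLM (n := Fin 3)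
      (𝕜 := ℂ) (T (e.symm (gen _ j)))) y‖ ^ 2 ≤ ‖y‖ ^ 2 :=
    (row_contractive_iff _).1
      (IsCompletelyContractive.row (hT.comp_symm he) (gen _) gen_row_contractive)
  -- The isomorphism need not respect generators, so the diagonal entries at the generators of the
  -- tensor algebra may be nonzero; they are the `z`, `p`, `q` here.
  obtain h1 | h1 := row_dichotomy
    (fun j => star (vertexHom hφ e₁.range (e.symm (gen _ j))))
    (fun j => star (G.edges.functional e₁ (e.symm (gen _ j))))
    (fun j => star (G.edges.functional e₂ (e.symm (gen _ j))))
    (fun j => star (vertexHom hφ e₁.source (e.symm (gen _ j))))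
    (fun j => star (vertexHom hφ e₂.source (e.symm (gen _ j))))
    (fun x y₁ y₂ => by
      refine le_trans (le_of_eq (Finset.sum_congr rfl fun j _ => ?_))
        ((hrow (WithLp.toLp 2 ![x, y₁, y₂])).trans_eq ?_)
      · rw [hTa, norm_sq_star_three]
        rfl
      · rw [EuclideanSpace.norm_sq_eq, Fin.sum_univ_three]
        rfl)
  · obtain ⟨T', hT', hT'a⟩ := G.edges.edgeFree e₁.range e₁.source e₁.idx
    exact not_row_of_edge he hφ (t := G.edges.functional e₁) hT' hT'a
      ((G.functional_gen e₁ (semicrossedPart σ e₁)).trans (if_pos rfl)) h1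
  · obtain ⟨T', hT', hT'a⟩ := G.edges.edgeFree e₂.range e₂.source e₂.idx
    rw [hr] at h1
    exact not_row_of_edge he hφ (t := G.edges.functional e₂) hT' hT'a
      ((G.functional_gen e₂ (semicrossedPart σ e₂)).trans (if_pos rfl)) h1

end Isomorphisms

end OpAlg
end

/-- The semicrossed product `C(X) ⋊_σ 𝔽ₙ⁺` has its canonical edge-partitioned graph, and it is
completely isometrically isomorphic to the tensor algebra of some multivariable dynamical system
if and only if this graph is 1-colorable. -/
theorem mainTheorem2 {X : Type u} [TopologicalSpace X] [CompactSpace X] [T2Space X]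
    (n : ℕ) (σ : Fin n → C(X, X)) :
    Nonempty (OpAlg.SemicrossedGraph σ) ∧
    ∀ G : OpAlg.SemicrossedGraph σ,
      (∃ (Y : Type u) (_ : TopologicalSpace Y) (_ : CompactSpace Y) (_ : T2Space Y)
          (m : ℕ) (τ : Fin m → C(Y, Y)),
        OpAlg.CompletelyIsometricallyIsomorphic (OpAlg.semicrossedProduct σ)
          (OpAlg.tensorAlgebra τ)) ↔
      G.Colorable 1 := by
  refine ⟨⟨OpAlg.canonicalGraph σ⟩, fun G => ⟨?_, fun hG => ?_⟩⟩
  · rintro ⟨Y, _, _, _, m, τ, h⟩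
    exact G.colorable_of_isomorphic h
  · exact ⟨X, inferInstance, inferInstance, inferInstance, n, σ, hG.isomorphic⟩
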